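/- **Setting.** Let $d\ge 2$ and let $\Omega_f,\Omega_p\subset\mathbb R^d$ be disjoint bounded polyhedral domains, $\Gamma=\partial\Omega_f\cap\partial\Omega_p$, $\boldsymbol n$ the unit normal on $\Gamma$ outward to $\Omega_f$; for a vector $\boldsymbol w$ on $\Gamma$ let $\boldsymbol w_{\boldsymbol t}=\boldsymbol w-(\boldsymbol w\cdot\boldsymbol n)\boldsymbol n$ be its tangential part (so $\boldsymbol w_{\boldsymbol t}=(\boldsymbol w\cdot\boldsymbol t)\boldsymbol t$ for $d=2$). $\|\cdot\|_S$ is the $L^2(S)$ norm, $\boldsymbol D(\boldsymbol v)=\frac12(\nabla\boldsymbol v+\nabla\boldsymbol v^T)$. Consider a family, indexed by the mesh characteristic size $h>0$, of shape-regular and quasi-uniform polytopal (e.g. simplicial) meshes of $\Omega_f$ and $\Omega_p$ and of finite element spaces of elementwise polynomials of bounded degree: $\mathbf V_h^f$ (fluid velocity, continuous), $Q_h^f$ (fluid pressure), $\mathbf V_h^p$ (Darcy velocity, $H(\mathrm{div})$-conforming), $Q_h^p$ (Darcy pressure), $\mathbf X_h^p$ (displacement, continuous), $\dot{\mathbf X}_h^p$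 (structure velocity); they may incorporate homogeneous Dirichlet conditions on the external boundaries. The parameters satisfy $\rho_f,\rho_p,\mu_f,\mu_p,\kappa>0$, $\lambda_p\ge0$, $s_0\in(0,1)$, $\alpha\in\mathbb R$. Put $\boldsymbol\sigma(\boldsymbol v,p)=-p\boldsymbol I+2\mu_f\boldsymbol D(\boldsymbol v)$, $a_s(\boldsymbol U,\boldsymbol\varphi)=2\mu_p\int_{\Omega_p}\boldsymbol D(\boldsymbol U):\boldsymbol D(\boldsymbol\varphi)+\lambda_p\int_{\Omega_p}(\nabla\cdot\boldsymbol U)(\nabla\cdot\boldsymbol\varphi)$, $b_s(p,\boldsymbol\varphi)=\alpha\int_{\Omega_p}p\,\nabla\cdot\boldsymbol\varphi$, $a_f(\boldsymbol v,\boldsymbol\varphi)=2\mu_f\int_{\Omega_f}\boldsymbol D(\boldsymbol v):\boldsymbol D(\boldsymbol\varphi)$, $b_f(p,\boldsymbol\varphi)=\int_{\Omega_f}p\,\nabla\cdot\boldsymbol\varphi$, $a_p(\boldsymbol q,\boldsymbol r)=\int_{\Omega_p}\kappa^{-1}\boldsymbol q\cdot\boldsymbol r$, $b_p(p,\boldsymbol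 r)=\int_{\Omega_p}p\,\nabla\cdot\boldsymbol r$. **Scheme.** Let $\tau>0$, $d_\tau u^n=\tau^{-1}(u^n-u^{n-1})$, $\gamma_f$ the penalty parameter and $\varsigma\in\{1,0,-1\}$ (symmetric, incomplete, skew-symmetric variant). Given initial values in the discrete spaces, $\boldsymbol v^n,p_f^n,\boldsymbol q^n,p_p^n,\boldsymbol U^n,\dot{\boldsymbol U}^n$ in the discrete spaces satisfy for $n=1,\dots,N$ and all test functions $\boldsymbol\varphi_f,\psi_f,\boldsymbol r,\psi_p,\boldsymbol\varphi_p,\dot{\boldsymbol\varphi}_p$ in the respective spaces $$\begin{aligned} &\rho_p\int_{\Omega_p}d_\tau\dot{\boldsymbol U}^n\cdot\boldsymbol\varphi_p+\rho_p\int_{\Omega_p}(\dot{\boldsymbol U}^n-d_\tau\boldsymbol U^n)\cdot\dot{\boldsymbol\varphi}_p+\rho_f\int_{\Omega_f}d_\tau\boldsymbol v^n\cdot\boldsymbol\varphi_f+s_0\int_{\Omega_p}d_\tau p_p^n\,\psi_p\\ &+a_s(\boldsymbol U^n,\boldsymbol\varphi_p)-b_s(p_p^n,\boldsymbol\varphi_p)+b_s(\psi_p,d_\tau\boldsymbol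 U^n)+a_p(\boldsymbol q^n,\boldsymbol r)-b_p(p_p^n,\boldsymbol r)+b_p(\psi_p,\boldsymbol q^n)\\ &+a_f(\boldsymbol v^n,\boldsymbol\varphi_f)-b_f(p_f^n,\boldsymbol\varphi_f)+b_f(\psi_f,\boldsymbol v^n)\\ &-\int_\Gamma \boldsymbol n\cdot\boldsymbol\sigma(\boldsymbol v^n,p_f^n)\boldsymbol n\,(\boldsymbol\varphi_f-\boldsymbol r-\boldsymbol\varphi_p)\cdot\boldsymbol n-\int_\Gamma(\boldsymbol\sigma(\boldsymbol v^n,p_f^n)\boldsymbol n)_{\boldsymbol t}\cdot(\boldsymbol\varphi_f-\boldsymbol\varphi_p)_{\boldsymbol t}\\ &+\int_\Gamma\gamma_f\mu_fh^{-1}\big[(\boldsymbol v^n-\boldsymbol q^n-d_\tau\boldsymbol U^n)\cdot\boldsymbol n\,(\boldsymbol\varphi_f-\boldsymbol r-\boldsymbol\varphi_p)\cdot\boldsymbol n+(\boldsymbol v^n-d_\tau\boldsymbol U^n)_{\boldsymbol t}\cdot(\boldsymbol\varphi_f-\boldsymbol\varphi_p)_{\boldsymbol t}\big]\\ &-\int_\Gamma\boldsymbol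 n\cdot\boldsymbol\sigma(\varsigma\boldsymbol\varphi_f,-\psi_f)\boldsymbol n\,(\boldsymbol v^n-\boldsymbol q^n-d_\tau\boldsymbol U^n)\cdot\boldsymbol n-\int_\Gamma(\boldsymbol\sigma(\varsigma\boldsymbol\varphi_f,-\psi_f)\boldsymbol n)_{\boldsymbol t}\cdot(\boldsymbol v^n-d_\tau\boldsymbol U^n)_{\boldsymbol t} =\mathcal F(t_n;\boldsymbol\varphi_f), \end{aligned}$$ where the linear forcing satisfies $\mathcal F(t_n;\boldsymbol\varphi_f)\le\|\mathcal F(t_n)\|\,\|\boldsymbol D(\boldsymbol\varphi_f)\|_{\Omega_f}$ for all $\boldsymbol\varphi_f\in\mathbf V_h^f$, with a real number $\|\mathcal F(t_n)\|$. The energies are $$E_f^n=\tfrac12\rho_f\|\boldsymbol v^n\|_{\Omega_f}^2,\qquad E_p^n=\tfrac12\big(\rho_p\|\dot{\boldsymbol U}^n\|_{\Omega_p}^2+2\mu_p\|\boldsymbol D(\boldsymbol U^n)\|_{\Omega_p}^2+\lambda_p\|\nabla\cdot\boldsymbol U^n\|_{\Omega_p}^2+s_0\|p_p^n\|_{\Omega_p}^2\big).$$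 **Theorem.** (a) There is $C_{TI}>0$ independent of $h$ with $$h\,\|\boldsymbol D(\boldsymbol u_h)\boldsymbol n\|_\Gamma^2\le C_{TI}\|\boldsymbol D(\boldsymbol u_h)\|_{\Omega_f}^2\qquad\text{for all }\boldsymbol u_h\in\mathbf V_h^f\text{ and all }h.$$ (b) Let $C_{TI}>0$ be any constant with this property, $\varsigma\in\{-1,0,1\}$, and let $\hat\epsilon,\check\epsilon>0$ satisfy $$1-\tfrac{\varsigma+1}{2}\hat\epsilon\,C_{TI}-\tfrac{\check\epsilon}{2}>0,\qquad \gamma_f>(\varsigma+1)\hat\epsilon^{-1}.$$ Then there are constants $0<c<1$ and $C>1$, depending only on $\varsigma,\hat\epsilon,\check\epsilon,C_{TI},\gamma_f$ (in particular not on $h$), such that for all $h$, all parameters, all $\tau>0$, $N\ge 0$, all forcings and all solutions of the scheme $$\begin{aligned} &E_f^N+E_p^N+c\,\tau\sum_{n=1}^N\Big[2\mu_f\|\boldsymbol D(\boldsymbol v^n)\|_{\Omega_f}^2+\kappa^{-1}\|\boldsymbol q^n\|_{\Omega_p}^2\\ &\quad+\tfrac\tau2\big(\rho_f\|d_\tau\boldsymbol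 v^n\|_{\Omega_f}^2+2\mu_p\|d_\tau\boldsymbol D(\boldsymbol U^n)\|_{\Omega_p}^2+s_0\|d_\tau p_p^n\|_{\Omega_p}^2+\lambda_p\|d_\tau\nabla\cdot\boldsymbol U^n\|_{\Omega_p}^2\big)\\ &\quad+\mu_fh^{-1}\big(\|(\boldsymbol v^n-\boldsymbol q^n-d_\tau\boldsymbol U^n)\cdot\boldsymbol n\|_\Gamma^2+\|(\boldsymbol v^n-d_\tau\boldsymbol U^n)_{\boldsymbol t}\|_\Gamma^2\big)\Big] \le E_f^0+E_p^0+\tau\sum_{n=1}^N\frac{C}{\mu_f}\|\mathcal F(t_n)\|^2 . \end{aligned}$$ More precisely, such $c, C$ can be chosen with $c<\min\{1-\frac{\varsigma+1}{2}\hat\epsilon C_{TI}-\frac{\check\epsilon}{2},\ \gamma_f-(\varsigma+1)\hat\epsilon^{-1}\}$ and $C>(2\check\epsilon)^{-1}$, and the estimate holds for every $c>0$ and $C$ within these bounds. -/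

import Mathlib

open MeasureTheory Set
open scoped Matrix ContDiff

noncomputable section

namespace StokesBiot

/-- Euclidean `d`-space. -/
abbrev E (d : ℕ) : Type := EuclideanSpace ℝ (Fin d)

/-! ### Differential operators on the closure of a domain -/

/-- Gradient matrix `(∇u)ᵢⱼ = ∂ⱼ uᵢ` of a vector field on `closure Ω`. The derivative is taken within
`closure Ω`, so that it is the usual one inside `Ω` and the one-sided trace from `Ω` on its boundary.
For piecewise polynomial fields it is the elementwise gradient, up to the skeleton of the mesh. -/
def gradMat {d : ℕ} (Ω : Set (E d)) (u : E d → E d) (x : E d) : Matrix (Fin d) (Fin d) ℝ :=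
  Matrix.of fun i j => fderivWithin ℝ u (closure Ω) x (EuclideanSpace.single j 1) i

/-- Symmetric gradient `D(u) = (∇u + (∇u)ᵀ) / 2`. -/
def symGrad {d : ℕ} (Ω : Set (E d)) (u : E d → E d) (x : E d) : Matrix (Fin d) (Fin d) ℝ :=
  (1 / 2 : ℝ) • (gradMat Ω u x + (gradMat Ω u x)ᵀ)

/-- Divergence `∇ · u`. -/
def dvg {d : ℕ} (Ω : Set (E d)) (u : E d → E d) (x : E d) : ℝ :=
  (gradMat Ω u x).trace

/-- Frobenius product `A : B`. -/
def frob {d : ℕ} (A B : Matrix (Fin d) (Fin d) ℝ) : ℝ :=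
  ∑ i, ∑ j, A i j * B i j

/-- The product `A n` of a matrix and a vector, as a Euclidean vector. -/
def mulVecE {d : ℕ} (A : Matrix (Fin d) (Fin d) ℝ) (n : E d) : E d :=
  WithLp.toLp 2 (A *ᵥ n.ofLp)

/-- The fluid stress `σ = -p I + 2 μ D`. -/
def stress {d : ℕ} (μ : ℝ) (D : Matrix (Fin d) (Fin d) ℝ) (p : ℝ) : Matrix (Fin d) (Fin d) ℝ :=
  (2 * μ) • D - p • (1 : Matrix (Fin d) (Fin d) ℝ)

/-! ### Interface geometry -/

/-- `n` is the outward unit normal of `Ω` at `x`: near `x` the set `Ω` is the open half-space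
`{y | (y - x) · n < 0}`. On the boundary of a polyhedral domain this holds at all points outside a
set of surface measure zero. -/
def IsOutwardNormal {d : ℕ} (Ω : Set (E d)) (x n : E d) : Prop :=
  ‖n‖ = 1 ∧ ∃ r > 0, ∀ y ∈ Metric.ball x r, y ∈ Ω ↔ inner ℝ (y - x) n < 0

open Classical in
/-- The outward unit normal field of `Ω` (zero where there is none). -/
def normal {d : ℕ} (Ω : Set (E d)) (x : E d) : E d :=
  if h : ∃ n, IsOutwardNormal Ω x n then h.choose else 0

/-- Tangential part `w - (w · n) n`. In two dimensions it equals `(w · t) t` for a unit tangent `t`. -/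
def tang {d : ℕ} (n w : E d) : E d :=
  w - (inner ℝ w n : ℝ) • n

/-- The fluid-structure interface `Γ = ∂Ω_f ∩ ∂Ω_p`. -/
def interfaceSet {d : ℕ} (Ωf Ωp : Set (E d)) : Set (E d) :=
  frontier Ωf ∩ frontier Ωp

/-- Surface integral over the interface. -/
def intΓ {d : ℕ} (Ωf Ωp : Set (E d)) (g : E d → ℝ) : ℝ :=
  ∫ x in interfaceSet Ωf Ωp, g x ∂(Measure.euclideanHausdorffMeasure (d - 1))

/-! ### Meshes and finite element functions -/

/-- `cells` is a finite mesh of `Ω` by closed polytopes (simplices, quadrilaterals, ...) that do not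
overlap. -/
def IsMesh {d : ℕ} (cells : Finset (Set (E d))) (Ω : Set (E d)) : Prop :=
  (∀ K ∈ cells, (∃ s : Finset (E d), K = convexHull ℝ (s : Set (E d))) ∧ (interior K).Nonempty) ∧
  (cells : Set (Set (E d))).PairwiseDisjoint interior ∧
  Ω = interior (⋃ K ∈ cells, K)

/-- Shape-regularity (with constant `ρ`) and quasi-uniformity (with constant `θ`) of a mesh of
characteristic size `h`. -/
def IsRegularMesh {d : ℕ} (cells : Finset (Set (E d))) (h ρ θ : ℝ) : Prop :=
  ∀ K ∈ cells,
    (∃ x : E d, ∃ r > 0, Metric.closedBall x r ⊆ K ∧ Metric.diam K ≤ ρ * r) ∧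
    Metric.diam K ≤ h ∧ h ≤ θ * Metric.diam K

/-- Real polynomial functions of total degree at most `k`. -/
def IsPoly {d : ℕ} (k : ℕ) (f : E d → ℝ) : Prop :=
  ∃ P : MvPolynomial (Fin d) ℝ, P.totalDegree ≤ k ∧ ∀ x, f x = MvPolynomial.eval (fun j => x j) P

/-- Vector fields with polynomial components of total degree at most `k`. -/
def IsVecPoly {d : ℕ} (k : ℕ) (f : E d → E d) : Prop :=
  ∀ j, IsPoly k fun x => f x j

/-- `f` is measurable and elementwise of the class `A`: on each cell it is the restriction of an
element of `A`, and at points shared by several cells it takes the value from one of them. -/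
def IsPiecewise {d : ℕ} {F : Type} [MeasurableSpace F] (cells : Finset (Set (E d)))
    (A : (E d → F) → Prop) (f : E d → F) : Prop :=
  Measurable f ∧ ∃ g : Set (E d) → E d → F,
    (∀ K ∈ cells, A (g K)) ∧ ∀ x ∈ ⋃ K ∈ cells, K, ∃ K ∈ cells, x ∈ K ∧ f x = g K x

/-- Conformity in `H(div; Ω)`: the elementwise divergence is the distributional divergence. -/
def IsHdiv {d : ℕ} (Ω : Set (E d)) (q : E d → E d) : Prop :=
  ∀ φ : E d → ℝ, ContDiff ℝ ∞ φ → HasCompactSupport φ → tsupport φ ⊆ Ω →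
    ∫ x in Ω, fderiv ℝ φ x (q x) = - ∫ x in Ω, dvg Ω q x * φ x

/-- The data of a spatial discretization: meshes of the fluid and of the poroelastic domain, their
characteristic size `h`, and the finite element spaces for the fluid velocity and pressure, the Darcy
velocity and pressure, the displacement and the structure velocity. -/
structure Discretization (d : ℕ) where
  meshF : Finset (Set (E d))
  meshP : Finset (Set (E d))
  h : ℝ
  h_pos : 0 < h
  Vf : Submodule ℝ (E d → E d)
  Qf : Submodule ℝ (E d → ℝ)
  Vp : Submodule ℝ (E d → E d)
  Qp : Submodule ℝ (E d → ℝ)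
  Xp : Submodule ℝ (E d → E d)
  Xdot : Submodule ℝ (E d → E d)

/-- The discretization consists of finite element spaces of degree at most `k` on meshes of the two
domains: velocities and displacements are continuous, Darcy velocities are `H(div)`-conforming,
pressures and structure velocities may be discontinuous. Being arbitrary linear subspaces, the spaces
can carry any homogeneous Dirichlet conditions on the external boundaries. -/
structure Discretization.IsFiniteElement {d : ℕ} (T : Discretization d) (Ωf Ωp : Set (E d)) (k : ℕ) :
    Prop where
  mesh_f : IsMesh T.meshF Ωf
  mesh_p : IsMesh T.meshP Ωp
  vf : ∀ v ∈ T.Vf, IsPiecewise T.meshF (IsVecPoly k) v ∧ ContinuousOn v (closure Ωf)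
  qf : ∀ p ∈ T.Qf, IsPiecewise T.meshF (IsPoly k) p
  vp : ∀ q ∈ T.Vp, IsPiecewise T.meshP (IsVecPoly k) q ∧ IsHdiv Ωp q
  qp : ∀ p ∈ T.Qp, IsPiecewise T.meshP (IsPoly k) p
  xp : ∀ U ∈ T.Xp, IsPiecewise T.meshP (IsVecPoly k) U ∧ ContinuousOn U (closure Ωp)
  xdot : ∀ W ∈ T.Xdot, IsPiecewise T.meshP (IsVecPoly k) W

/-- Both meshes are shape-regular and quasi-uniform. -/
def Discretization.IsRegular {d : ℕ} (T : Discretization d) (ρ θ : ℝ) : Prop :=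
  IsRegularMesh T.meshF T.h ρ θ ∧ IsRegularMesh T.meshP T.h ρ θ

/-- The trace inequality `h ‖D(u) n‖²_Γ ≤ C_TI ‖D(u)‖²_{Ω_f}` on the fluid velocity space. -/
def Discretization.TraceInverse {d : ℕ} (T : Discretization d) (Ωf Ωp : Set (E d)) (CTI : ℝ) :
    Prop :=
  ∀ u ∈ T.Vf,
    T.h * intΓ Ωf Ωp (fun x => ‖mulVecE (symGrad Ωf u x) (normal Ωf x)‖ ^ 2)
      ≤ CTI * ∫ x in Ωf, frob (symGrad Ωf u x) (symGrad Ωf u x)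

/-! ### The fully discrete scheme -/

/-- The physical parameters: densities, fluid viscosity, Lamé coefficients, Biot-Willis constant,
hydraulic conductivity, storage coefficient. -/
structure Physical where
  ρf : ℝ
  ρp : ℝ
  μf : ℝ
  μp : ℝ
  lam : ℝ
  α : ℝ
  κ : ℝ
  s₀ : ℝ
  ρf_pos : 0 < ρf
  ρp_pos : 0 < ρp
  μf_pos : 0 < μf
  μp_pos : 0 < μp
  lam_nonneg : 0 ≤ lam
  κ_pos : 0 < κ
  s₀_pos : 0 < s₀
  s₀_lt_one : s₀ < 1

/-- The unknowns `(v, p_f, q, p_p, U, U̇)` at one time level, or a tuple of test functions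
`(φ_f, ψ_f, r, ψ_p, φ_p, φ̇_p)`. -/
structure State (d : ℕ) where
  v : E d → E d
  pf : E d → ℝ
  q : E d → E d
  pp : E d → ℝ
  U : E d → E d
  Udot : E d → E d

/-- All components lie in the finite element spaces. -/
def Discretization.Has {d : ℕ} (T : Discretization d) (z : State d) : Prop :=
  z.v ∈ T.Vf ∧ z.pf ∈ T.Qf ∧ z.q ∈ T.Vp ∧ z.pp ∈ T.Qp ∧ z.U ∈ T.Xp ∧ z.Udot ∈ T.Xdot

/-- Backward difference quotient `τ⁻¹ (u - u_old)`. -/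
def dq {M : Type} [AddCommGroup M] [Module ℝ M] (τ : ℝ) (u uold : M) : M :=
  τ⁻¹ • (u - uold)

section Forms

variable {d : ℕ} (Ωf Ωp : Set (E d)) (P : Physical)

/-- `a_s(U, φ)`. -/
def aS (U φ : E d → E d) : ℝ :=
  2 * P.μp * (∫ x in Ωp, frob (symGrad Ωp U x) (symGrad Ωp φ x))
    + P.lam * ∫ x in Ωp, dvg Ωp U x * dvg Ωp φ x

/-- `b_s(p, φ)`. -/
def bS (p : E d → ℝ) (φ : E d → E d) : ℝ :=
  P.α * ∫ x in Ωp, p x * dvg Ωp φ x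

/-- `a_f(v, φ)`. -/
def aF (v φ : E d → E d) : ℝ :=
  2 * P.μf * ∫ x in Ωf, frob (symGrad Ωf v x) (symGrad Ωf φ x)

/-- `b_f(p, φ)`. -/
def bF (p : E d → ℝ) (φ : E d → E d) : ℝ :=
  ∫ x in Ωf, p x * dvg Ωf φ x

/-- `a_p(q, r)`. -/
def aP (q r : E d → E d) : ℝ :=
  ∫ x in Ωp, P.κ⁻¹ * inner ℝ (q x) (r x)

/-- `b_p(p, r)`. -/
def bP (p : E d → ℝ) (r : E d → E d) : ℝ :=
  ∫ x in Ωp, p x * dvg Ωp r x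

/-- The Nitsche terms `-I_Γ^*` with penalty `γ`, where `dU` stands for the discrete time derivative
of the displacement. -/
def nitscheI (γ h : ℝ) (v : E d → E d) (pf : E d → ℝ) (q dU φf r φp : E d → E d) : ℝ :=
  - intΓ Ωf Ωp (fun x =>
      inner ℝ (normal Ωf x) (mulVecE (stress P.μf (symGrad Ωf v x) (pf x)) (normal Ωf x))
        * inner ℝ (φf x - r x - φp x) (normal Ωf x))
  - intΓ Ωf Ωp (fun x =>
      inner ℝ
        (tang (normal Ωf x) (mulVecE (stress P.μf (symGrad Ωf v x) (pf x)) (normal Ωf x)))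
        (tang (normal Ωf x) (φf x - φp x)))
  + intΓ Ωf Ωp (fun x => γ * P.μf * h⁻¹ *
      (inner ℝ (v x - q x - dU x) (normal Ωf x) * inner ℝ (φf x - r x - φp x) (normal Ωf x)
        + inner ℝ (tang (normal Ωf x) (v x - dU x)) (tang (normal Ωf x) (φf x - φp x))))

/-- The consistent terms `-S_Γ^{*,ς}` of the symmetric (`ς = 1`), incomplete (`ς = 0`) or
skew-symmetric (`ς = -1`) variant. -/
def nitscheS (ς : ℝ) (v q dU φf : E d → E d) (ψf : E d → ℝ) : ℝ :=
  - intΓ Ωf Ωp (fun x =>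
      inner ℝ (normal Ωf x)
          (mulVecE (stress P.μf (symGrad Ωf (ς • φf) x) (- ψf x)) (normal Ωf x))
        * inner ℝ (v x - q x - dU x) (normal Ωf x))
  - intΓ Ωf Ωp (fun x =>
      inner ℝ
        (tang (normal Ωf x)
          (mulVecE (stress P.μf (symGrad Ωf (ς • φf) x) (- ψf x)) (normal Ωf x)))
        (tang (normal Ωf x) (v x - dU x)))

/-- The left-hand side of the implicitly coupled backward Euler scheme, for the state `y` at the
current time level, the state `y₀` at the previous one, and the test functions `z`. -/
def dipForm (γ ς h τ : ℝ) (y y₀ z : State d) : ℝ :=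
  P.ρp * (∫ x in Ωp, inner ℝ (dq τ y.Udot y₀.Udot x) (z.U x))
  + P.ρp * (∫ x in Ωp, inner ℝ (y.Udot x - dq τ y.U y₀.U x) (z.Udot x))
  + P.ρf * (∫ x in Ωf, inner ℝ (dq τ y.v y₀.v x) (z.v x))
  + P.s₀ * (∫ x in Ωp, dq τ y.pp y₀.pp x * z.pp x)
  + aS Ωp P y.U z.U - bS Ωp P y.pp z.U + bS Ωp P z.pp (dq τ y.U y₀.U)
  + aP Ωp P y.q z.q - bP Ωp y.pp z.q + bP Ωp z.pp y.q
  + aF Ωf P y.v z.v - bF Ωf y.pf z.v + bF Ωf z.pf y.v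
  + nitscheI Ωf Ωp P γ h y.v y.pf y.q (dq τ y.U y₀.U) z.v z.q z.U
  + nitscheS Ωf Ωp P ς y.v y.q (dq τ y.U y₀.U) z.v z.pf

/-- Fluid energy. -/
def energyF (y : State d) : ℝ :=
  1 / 2 * (P.ρf * ∫ x in Ωf, ‖y.v x‖ ^ 2)

/-- Poroelastic energy. -/
def energyP (y : State d) : ℝ :=
  1 / 2 * (P.ρp * (∫ x in Ωp, ‖y.Udot x‖ ^ 2)
    + 2 * P.μp * (∫ x in Ωp, frob (symGrad Ωp y.U x) (symGrad Ωp y.U x))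
    + P.lam * (∫ x in Ωp, dvg Ωp y.U x ^ 2)
    + P.s₀ * ∫ x in Ωp, y.pp x ^ 2)

/-- The dissipation at one time step: viscous and Darcy dissipation, numerical dissipation of the
backward Euler method, and interface jumps. -/
def dissipation (h τ : ℝ) (y y₀ : State d) : ℝ :=
  2 * P.μf * (∫ x in Ωf, frob (symGrad Ωf y.v x) (symGrad Ωf y.v x))
  + P.κ⁻¹ * (∫ x in Ωp, ‖y.q x‖ ^ 2)
  + τ / 2 *
    (P.ρf * (∫ x in Ωf, ‖dq τ y.v y₀.v x‖ ^ 2)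
      + 2 * P.μp * (∫ x in Ωp, frob (dq τ (symGrad Ωp y.U x) (symGrad Ωp y₀.U x))
          (dq τ (symGrad Ωp y.U x) (symGrad Ωp y₀.U x)))
      + P.s₀ * (∫ x in Ωp, dq τ y.pp y₀.pp x ^ 2)
      + P.lam * (∫ x in Ωp, dq τ (dvg Ωp y.U x) (dvg Ωp y₀.U x) ^ 2))
  + P.μf * h⁻¹ *
    (intΓ Ωf Ωp (fun x =>
        (inner ℝ (y.v x - y.q x - dq τ y.U y₀.U x) (normal Ωf x) : ℝ) ^ 2)
      + intΓ Ωf Ωp (fun x => ‖tang (normal Ωf x) (y.v x - dq τ y.U y₀.U x)‖ ^ 2))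

end Forms

/-- `F` is a forcing on the fluid velocity space with `F(t_n; φ) ≤ ‖F(t_n)‖ ‖D(φ)‖_{Ω_f}`, where
`nF n` is the number `‖F(t_n)‖`. -/
def Discretization.IsForcing {d : ℕ} (T : Discretization d) (Ωf : Set (E d)) (N : ℕ)
    (F : ℕ → T.Vf →ₗ[ℝ] ℝ) (nF : ℕ → ℝ) : Prop :=
  ∀ n ∈ Finset.Icc 1 N, ∀ φ : T.Vf,
    F n φ ≤ nF n * Real.sqrt (∫ x in Ωf, frob (symGrad Ωf φ x) (symGrad Ωf φ x))

/-- `y 0, ..., y N` is a solution of the fully discrete implicitly coupled problem. The initial state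
is an arbitrary element of the discrete spaces. -/
def Discretization.IsSolution {d : ℕ} (T : Discretization d) (Ωf Ωp : Set (E d)) (P : Physical)
    (γ ς τ : ℝ) (N : ℕ) (F : ℕ → T.Vf →ₗ[ℝ] ℝ) (y : ℕ → State d) : Prop :=
  (∀ n ≤ N, T.Has (y n)) ∧
  ∀ n ∈ Finset.Icc 1 N, ∀ (z : State d) (hz : T.Has z),
    dipForm Ωf Ωp P γ ς T.h τ (y n) (y (n - 1)) z = F n ⟨z.v, hz.1⟩

/-- The energy estimate with constants `c` and `C`, for all members of a family of discretizations,
all physical parameters, time steps, forcings and discrete solutions. -/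
def EnergyStable {d : ℕ} {ι : Type*} (T : ι → Discretization d) (Ωf Ωp : Set (E d)) (γ ς c C : ℝ) :
    Prop :=
  ∀ (i : ι) (P : Physical) (τ : ℝ) (N : ℕ) (F : ℕ → (T i).Vf →ₗ[ℝ] ℝ) (nF : ℕ → ℝ)
    (y : ℕ → State d),
    0 < τ → (T i).IsForcing Ωf N F nF → (T i).IsSolution Ωf Ωp P γ ς τ N F y →
    energyF Ωf P (y N) + energyP Ωp P (y N)
        + c * (τ * ∑ n ∈ Finset.Icc 1 N, dissipation Ωf Ωp P (T i).h τ (y n) (y (n - 1)))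
      ≤ energyF Ωf P (y 0) + energyP Ωp P (y 0)
        + τ * ∑ n ∈ Finset.Icc 1 N, C / P.μf * nF n ^ 2

end StokesBiot

end

/-!
The estimate follows by testing the scheme with the discrete solution itself, taking `d_τ U` and
`d_τ U̇` for the two test functions of the structure (`energyTest`). The mixed terms `b_s`, `b_p`, `b_f`
then cancel, and `τ (d_τ a) a = (a² - b² + τ² (d_τ a)²) / 2` turns the remaining bulk terms into energy
increments and numerical dissipation (`dipForm_energyTest`). On the interface the pressure drops out of
the two groups of Nitsche terms, which leaves `-(1 + ς) ∫ 2 μ_f D(v) n · J` and the penalty on the jumps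
`J`. Young's inequality with weight `εhat h` absorbs the former into the penalty and into
`h ‖D(v) n‖²` (`nitsche_ge`), and the trace inequality moves the latter into the viscous dissipation.
The forcing is treated by Young's inequality with weight `εcheck`, and summation over the time steps
concludes (`energy_step`, `energyStable_of_traceInverse`).

The trace inequality (`exists_traceInverse`) holds cell by cell. On a cell `K` the field `D(u)` is
polynomial, so its maximum over `K` is controlled by its mean square over an inscribed ball of radius
`r` comparable to `h` (equivalence of norms on polynomials of bounded degree, and scaling:
`exists_sq_eval_le_integral_ball`). The surface measure of `∂K` is at most of order `r ^ (d - 1)`,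
whatever the number of facets, because the nearest point projection maps the boundary of a circumscribed
cube onto `∂K` without increasing distances (`exists_surface_le`).

Splitting the interface integrals requires integrability. The normal field is locally constant where it
exists. The gradient taken within `closure Ω` equals, at each point, the gradient of an adjacent
polynomial piece if all adjacent pieces agree to first order, and zero otherwise; hence it is bounded
and measurable on the interface, although that may meet the mesh skeleton
(`IsCellwise.differentiableWithinAt_iff`, `IsCellwise.aestronglyMeasurable_gradMat`).
-/

noncomputable section

namespace StokesBiot

/-! ### Polynomial functions and the inverse estimate on balls -/

section Polynomial

variable {d k : ℕ}

theorem totalDegree_pderiv_le {σ : Type*} (i : σ) (P : MvPolynomial σ ℝ) :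
    (MvPolynomial.pderiv i P).totalDegree ≤ P.totalDegree := by
  classical
  refine Finset.sup_le fun m hm => ?_
  rw [MvPolynomial.mem_support_iff, MvPolynomial.coeff_pderiv] at hm
  have h : m + Finsupp.single i 1 ∈ P.support :=
    MvPolynomial.mem_support_iff.2 (left_ne_zero_of_mul hm)
  have h2 := MvPolynomial.le_totalDegree h
  refine le_trans ?_ h2
  have h3 := (Finsupp.degree (R := ℕ)).map_add m (Finsupp.single i 1)
  change Finsupp.degree m ≤ Finsupp.degree (m + Finsupp.single i 1)
  omega

theorem totalDegree_bind₁_le {σ τ : Type*} (f : σ → MvPolynomial τ ℝ)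
    (hf : ∀ i, (f i).totalDegree ≤ 1) (P : MvPolynomial σ ℝ) :
    (MvPolynomial.bind₁ f P).totalDegree ≤ P.totalDegree := by
  rw [MvPolynomial.bind₁, MvPolynomial.aeval_def, MvPolynomial.eval₂_eq]
  refine MvPolynomial.totalDegree_finsetSum_le fun m hm => ?_
  refine (MvPolynomial.totalDegree_mul _ _).trans ?_
  have h1 : (algebraMap ℝ (MvPolynomial τ ℝ) (MvPolynomial.coeff m P)).totalDegree = 0 :=
    MvPolynomial.totalDegree_C _
  rw [h1, zero_add]
  refine (MvPolynomial.totalDegree_finsetProd _ _).trans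
    (le_trans ?_ (MvPolynomial.le_totalDegree hm))
  refine Finset.sum_le_sum fun i _ => ?_
  refine (MvPolynomial.totalDegree_pow _ _).trans ?_
  simpa using Nat.mul_le_mul_left (m i) (hf i)

theorem continuous_eval_coord (P : MvPolynomial (Fin d) ℝ) :
    Continuous fun x : E d => MvPolynomial.eval (fun j => x j) P := by
  have h : Continuous fun x : E d => (fun j => x j : Fin d → ℝ) := by fun_prop
  exact (MvPolynomial.continuous_eval P).comp h

/-- The derivative of a polynomial function is given by the formal partial derivatives. -/
theorem hasFDerivAt_eval_coord (P : MvPolynomial (Fin d) ℝ) (x : E d) :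
    HasFDerivAt (fun x : E d => MvPolynomial.eval (fun j => x j) P)
      (∑ j, MvPolynomial.eval (fun j => x j) (MvPolynomial.pderiv j P) •
        (EuclideanSpace.proj j : E d →L[ℝ] ℝ)) x := by
  induction P using MvPolynomial.induction_on with
  | C a => simpa using hasFDerivAt_const a x
  | add p q hp hq =>
    refine (hp.add hq).congr_fderiv ?_ |>.congr_of_eventuallyEq (.of_forall fun y => by simp)
    simp [add_smul, Finset.sum_add_distrib]
  | mul_X p i hp =>
    have hX : HasFDerivAt (fun x : E d => x i) (EuclideanSpace.proj i : E d →L[ℝ] ℝ) x :=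
      (EuclideanSpace.proj i : E d →L[ℝ] ℝ).hasFDerivAt
    refine (hp.mul hX).congr_fderiv ?_ |>.congr_of_eventuallyEq (.of_forall fun y => by simp)
    simp only [MvPolynomial.pderiv_mul, map_add, map_mul, MvPolynomial.eval_X, add_smul,
      Finset.sum_add_distrib, Finset.smul_sum, smul_smul, mul_comm (x i)]
    rw [add_comm]
    congr 1
    rw [Finset.sum_eq_single i] <;> simp +contextual [MvPolynomial.pderiv_X]

/-- Two norms on a finite-dimensional space of polynomials: the maximum over a large ball is bounded
by the mean square over the unit ball. -/
theorem exists_sq_eval_le_integral_unitBall (d k : ℕ) (ρ : ℝ) :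
    ∃ C : ℝ, 0 ≤ C ∧ ∀ P : MvPolynomial (Fin d) ℝ, P.totalDegree ≤ k → ∀ y : E d, ‖y‖ ≤ ρ →
      (MvPolynomial.eval (fun j => y j) P) ^ 2
        ≤ C * ∫ x in Metric.ball (0 : E d) 1, (MvPolynomial.eval (fun j => x j) P) ^ 2 := by
  let V := MvPolynomial.restrictTotalDegree (Fin d) ℝ k
  let μ : Measure (E d) := volume.restrict (Metric.ball 0 1)
  have hmem (P : MvPolynomial (Fin d) ℝ) :
      MemLp (fun x : E d => MvPolynomial.eval (fun j => x j) P) 2 μ := by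
    rw [memLp_two_iff_integrable_sq (continuous_eval_coord P).aestronglyMeasurable]
    exact (((continuous_eval_coord P).pow 2).continuousOn.integrableOn_compact
      (isCompact_closedBall (0 : E d) 1)).mono_set Metric.ball_subset_closedBall
  let T : V →ₗ[ℝ] Lp ℝ 2 μ :=
    { toFun := fun P => (hmem P.1).toLp _
      map_add' := fun P Q => by
        rw [← MemLp.toLp_add]; exact MemLp.toLp_congr _ _ (.of_forall fun x => by simp)
      map_smul' := fun a P => by
        rw [RingHom.id_apply, ← MemLp.toLp_const_smul]
        exact MemLp.toLp_congr _ _ (.of_forall fun x => by simp) }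
  let S : V →ₗ[ℝ] C(Metric.closedBall (0 : E d) ρ, ℝ) :=
    { toFun := fun P => ⟨fun x => MvPolynomial.eval (fun j => x.1 j) P.1,
        (continuous_eval_coord P.1).comp continuous_subtype_val⟩
      map_add' := fun P Q => by ext; simp
      map_smul' := fun a P => by ext; simp }
  have hT : T.ker = ⊥ := by
    rw [LinearMap.ker_eq_bot']
    intro P hP
    have h0 : (fun x : E d => MvPolynomial.eval (fun j => x j) P.1)
        =ᵐ[volume.restrict (Metric.ball 0 1)] fun _ => (0 : ℝ) := by
      have h1 : (hmem P.1).toLp _ = 0 := hP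
      exact (hmem P.1).coeFn_toLp.symm.trans (h1 ▸ Lp.coeFn_zero _ _ _)
    have h1 := Measure.eqOn_open_of_ae_eq h0 Metric.isOpen_ball
      (continuous_eval_coord P.1).continuousOn continuousOn_const
    refine Subtype.ext ?_
    obtain ⟨δ, hδ, hδ'⟩ : ∃ δ > 0, ∀ x : Fin d → ℝ, (∀ i, x i ∈ Ioo (-δ) δ) →
        WithLp.toLp 2 x ∈ Metric.ball (0 : E d) 1 := by
      have hc : Continuous fun x : Fin d → ℝ => (WithLp.toLp 2 x : E d) :=
        PiLp.continuous_toLp 2 _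
      have hn : (fun x : Fin d → ℝ => (WithLp.toLp 2 x : E d)) ⁻¹' Metric.ball 0 1
          ∈ nhds (0 : Fin d → ℝ) :=
        (Metric.isOpen_ball.preimage hc).mem_nhds (by simp)
      obtain ⟨δ, hδ, h⟩ := Metric.mem_nhds_iff.1 hn
      refine ⟨δ, hδ, fun x hx => h ?_⟩
      rw [mem_ball_zero_iff, pi_norm_lt_iff hδ]
      exact fun i => abs_lt.2 (hx i)
    refine MvPolynomial.funext_set (fun _ => Ioo (-δ) δ) (fun _ => Ioo_infinite (by linarith))
      fun x hx => ?_
    have := h1 (hδ' x fun i => hx i (mem_univ i))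
    simpa using this
  obtain ⟨R, hR⟩ := LinearMap.exists_leftInverse_of_injective T hT
  -- A linear map on the finite-dimensional range of `T` is bounded.
  let L : T.range →L[ℝ] C(Metric.closedBall (0 : E d) ρ, ℝ) :=
    LinearMap.toContinuousLinearMap ((S ∘ₗ R) ∘ₗ T.range.subtype)
  refine ⟨‖L‖ ^ 2, by positivity, fun P hP y hy => ?_⟩
  let P' : V := ⟨P, (MvPolynomial.mem_restrictTotalDegree _ _ _).2 hP⟩
  have hL : L ⟨T P', LinearMap.mem_range_self T P'⟩ = S P' := by
    have : R (T P') = P' := LinearMap.congr_fun hR P'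
    simp [L, this]
  have h1 : ‖S P'‖ ≤ ‖L‖ * ‖T P'‖ := by
    rw [← hL]; exact L.le_opNorm _
  have h2 : |MvPolynomial.eval (fun j => y j) P| ≤ ‖S P'‖ :=
    (S P').norm_coe_le_norm ⟨y, by simpa using hy⟩
  have h3 : ‖T P'‖ ^ 2 = ∫ x in Metric.ball (0 : E d) 1,
      (MvPolynomial.eval (fun j => x j) P) ^ 2 := by
    rw [← real_inner_self_eq_norm_sq, L2.inner_def]
    refine integral_congr_ae ((hmem P).coeFn_toLp.mono fun x hx => ?_)
    have hx' : (T P') x = MvPolynomial.eval (fun j => x j) P := hx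
    simp [hx', sq]
  calc (MvPolynomial.eval (fun j => y j) P) ^ 2
      = |MvPolynomial.eval (fun j => y j) P| ^ 2 := (sq_abs _).symm
    _ ≤ (‖L‖ * ‖T P'‖) ^ 2 := by gcongr; exact h2.trans h1
    _ = _ := by rw [mul_pow, h3]

/-- The inverse estimate `max_{B(x₀, ρ r)} P² ≤ C r⁻ᵈ ∫_{B(x₀, r)} P²` for polynomials of bounded
degree, by scaling from the unit ball. -/
theorem exists_sq_eval_le_integral_ball (d k : ℕ) (ρ : ℝ) :
    ∃ C : ℝ, 0 ≤ C ∧ ∀ P : MvPolynomial (Fin d) ℝ, P.totalDegree ≤ k → ∀ (x₀ : E d) (r : ℝ), 0 < r →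
      ∀ y : E d, ‖y - x₀‖ ≤ ρ * r →
      (MvPolynomial.eval (fun j => y j) P) ^ 2
        ≤ C * (r ^ d)⁻¹ * ∫ x in Metric.ball x₀ r, (MvPolynomial.eval (fun j => x j) P) ^ 2 := by
  obtain ⟨C, hC, h⟩ := exists_sq_eval_le_integral_unitBall d k ρ
  refine ⟨C, hC, fun P hP x₀ r hr y hy => ?_⟩
  let f : Fin d → MvPolynomial (Fin d) ℝ := fun j =>
    MvPolynomial.C (x₀ j) + MvPolynomial.C r * MvPolynomial.X j
  have hf : ∀ j, (f j).totalDegree ≤ 1 := fun j => by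
    refine (MvPolynomial.totalDegree_add _ _).trans (max_le (by simp) ?_)
    exact (MvPolynomial.totalDegree_mul _ _).trans (by simp)
  have heval (z : E d) : MvPolynomial.eval (fun j => z j) (MvPolynomial.bind₁ f P)
      = MvPolynomial.eval (fun j => (x₀ + r • z) j) P := by
    refine (MvPolynomial.eval₂Hom_bind₁ (RingHom.id ℝ) _ f P).trans ?_
    change MvPolynomial.eval (fun i => MvPolynomial.eval (fun j => z j) (f i)) P = _
    congr 2
    funext i
    simp [f]
  have h1 := h (MvPolynomial.bind₁ f P) ((totalDegree_bind₁_le f hf P).trans hP)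
    (r⁻¹ • (y - x₀)) (by
      rw [norm_smul, norm_inv, Real.norm_of_nonneg hr.le, inv_mul_le_iff₀ hr]
      linarith)
  simp only [heval, smul_smul, mul_inv_cancel₀ hr.ne', one_smul, add_sub_cancel] at h1
  refine h1.trans_eq ?_
  have h2 := Measure.setIntegral_comp_smul_of_pos (volume : Measure (E d))
    (fun z : E d => (MvPolynomial.eval (fun j => (x₀ + z) j) P) ^ 2) (Metric.ball 0 1) hr
  rw [h2, smul_unitBall_of_pos hr, mul_assoc, smul_eq_mul, finrank_euclideanSpace_fin]
  congr 2
  have h3 := (measurePreserving_add_left (volume : Measure (E d)) x₀).setIntegral_preimage_emb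
    (measurableEmbedding_addLeft x₀) (fun z : E d => (MvPolynomial.eval (fun j => z j) P) ^ 2)
    (Metric.ball x₀ r)
  rw [← h3]
  simp

end Polynomial

/-! ### Surface measure of the boundary of a convex body -/

section Surface

/-- Supporting hyperplanes: at a boundary point of a convex set with interior points there is a
nonzero outward normal vector. -/
theorem exists_outward_vector {d : ℕ} {K : Set (E d)} (hK : Convex ℝ K)
    (hint : (interior K).Nonempty) {x : E d} (hx : x ∈ frontier K) :
    ∃ ν : E d, ν ≠ 0 ∧ ∀ y ∈ K, inner ℝ ν (y - x) ≤ 0 := by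
  obtain ⟨f, hf⟩ := geometric_hahn_banach_open_point hK.interior isOpen_interior hx.2
  refine ⟨(InnerProductSpace.toDual ℝ (E d)).symm f, fun h0 => ?_, fun y hy => ?_⟩
  · obtain ⟨z, hz⟩ := hint
    have hf0 : f = 0 := by simpa using h0
    simpa [hf0] using hf z hz
  · rw [InnerProductSpace.toDual_symm_apply, map_sub, sub_nonpos]
    have hcl : y ∈ closure (interior K) := by
      rw [hK.closure_interior_eq_closure_of_nonempty_interior hint]; exact subset_closure hy
    exact closure_minimal (fun z hz => (hf z hz).le)
      (isClosed_le f.continuous continuous_const) hcl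

theorem exists_ray_meets_cube {d : ℕ} {x x₀ ν : E d} {R : ℝ} (hν : ν ≠ 0)
    (hx : ‖x - x₀‖ ≤ R) : ∃ t : ℝ, 0 ≤ t ∧ ‖(x + t • ν - x₀).ofLp‖ = R := by
  let g : ℝ → ℝ := fun t => ‖(x + t • ν - x₀).ofLp‖
  have hg : Continuous g := by
    have : Continuous fun y : E d => y.ofLp := PiLp.continuous_ofLp 2 _
    exact (this.comp (by fun_prop)).norm
  have hν' : 0 < ‖ν.ofLp‖ := norm_pos_iff.2 fun h => hν (by ext i; simpa using congrFun h i)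
  have h0 : g 0 ≤ R := by
    have h1 : ‖(x - x₀).ofLp‖ ≤ ‖x - x₀‖ := by
      rw [pi_norm_le_iff_of_nonneg (norm_nonneg _)]
      exact fun i => PiLp.norm_apply_le _ i
    simpa [g] using h1.trans hx
  have hR : 0 ≤ R := (norm_nonneg _).trans hx
  have h1 : R ≤ g (2 * R / ‖ν.ofLp‖) := by
    have h2 : ‖((2 * R / ‖ν.ofLp‖) • ν).ofLp‖ ≤ g (2 * R / ‖ν.ofLp‖) + g 0 := by
      have := norm_sub_le (x + (2 * R / ‖ν.ofLp‖) • ν - x₀).ofLp (x + (0 : ℝ) • ν - x₀).ofLp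
      refine le_trans (le_of_eq ?_) this
      congr 1
      ext i
      simp
    rw [WithLp.ofLp_smul, norm_smul, Real.norm_of_nonneg (by positivity),
      div_mul_cancel₀ _ hν'.ne'] at h2
    linarith
  obtain ⟨t, ht, hgt⟩ := intermediate_value_Icc (by positivity : 0 ≤ 2 * R / ‖ν.ofLp‖)
    hg.continuousOn ⟨h0, h1⟩
  exact ⟨t, ht.1, hgt⟩

/-- The sphere of the maximum norm is a union of facets, each a Lipschitz image of a cube of dimension
`m`. -/
theorem cubeSphere_subset {m : ℕ} (x₀ : E (m + 1)) (R : ℝ) :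
    {y : E (m + 1) | ‖(y - x₀).ofLp‖ = R} ⊆
      ⋃ p : Fin (m + 1) × Bool,
        (fun z : Fin m → ℝ => x₀ +
          (WithLp.toLp 2 (Fin.insertNth p.1 (if p.2 then R else -R) z) : E (m + 1))) ''
        Metric.closedBall 0 R := by
  intro y hy
  have hy' : ‖(y - x₀).ofLp‖ = R := hy
  obtain ⟨i, hi⟩ : ∃ i, ‖(y - x₀).ofLp i‖ = ‖(y - x₀).ofLp‖ := by
    obtain ⟨i, hi⟩ := Finite.exists_max fun i => ‖(y - x₀).ofLp i‖
    exact ⟨i, le_antisymm (norm_le_pi_norm _ i) ((pi_norm_le_iff_of_nonneg (norm_nonneg _)).2 hi)⟩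
  have hR : 0 ≤ R := hy' ▸ norm_nonneg _
  rw [hy', Real.norm_eq_abs] at hi
  refine mem_iUnion.2 ⟨(i, decide (0 ≤ (y - x₀).ofLp i)), i.removeNth (y - x₀).ofLp, ?_, ?_⟩
  · rw [mem_closedBall_zero_iff, pi_norm_le_iff_of_nonneg hR]
    exact fun j => hy' ▸ norm_le_pi_norm (y - x₀).ofLp _
  · have h1 : (if decide (0 ≤ (y - x₀).ofLp i) then R else -R) = (y - x₀).ofLp i := by
      by_cases h : 0 ≤ (y - x₀).ofLp i
      · simp only [h, decide_true, if_true]; rw [← hi, abs_of_nonneg h]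
      · simp only [h, decide_false]; rw [← hi, abs_of_neg (not_le.1 h)]; simp
    simp only [h1, Fin.insertNth_self_removeNth]
    simp

/-- A convex body inside a ball of radius `R` has surface measure at most `C Rᵐ`. The nearest point
projection onto the body is non-expansive and maps the boundary of a circumscribed cube onto the
boundary of the body. -/
theorem exists_surface_le (m : ℕ) :
    ∃ C : NNReal, ∀ (K : Set (E (m + 1))) (x₀ : E (m + 1)) (R : ℝ), Convex ℝ K → IsClosed K →
      (interior K).Nonempty → K ⊆ Metric.closedBall x₀ R →
      Measure.euclideanHausdorffMeasure m (frontier K) ≤ C * ENNReal.ofReal (R ^ m) := by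
  classical
  obtain ⟨c, hc⟩ : ∃ c : NNReal,
      (Measure.euclideanHausdorffMeasure m : Measure (E (m + 1))) = c • Measure.hausdorffMeasure m :=
    ⟨_, Measure.euclideanHausdorffMeasure_def m⟩
  obtain ⟨L, hL⟩ : ∃ L : NNReal, ∀ (x₀ : E (m + 1)) (i : Fin (m + 1)) (s : ℝ),
      LipschitzWith L (fun z : Fin m → ℝ => x₀ +
        (WithLp.toLp 2 (Fin.insertNth i s z) : E (m + 1))) := by
    refine ⟨_, fun x₀ i s => LipschitzWith.comp (LipschitzWith.of_dist_le_mul (K := 1) ?_)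
      ((PiLp.lipschitzWith_toLp 2 _).comp (LipschitzWith.of_dist_le_mul (K := 1) ?_))⟩
    · intro y z; simp
    · intro y z
      rw [NNReal.coe_one, one_mul, dist_pi_le_iff dist_nonneg]
      intro j
      rcases Fin.eq_self_or_eq_succAbove i j with rfl | ⟨j, rfl⟩
      · simp
      · simpa using dist_le_pi_dist y z j
  refine ⟨c * (2 * (m + 1) * L ^ m * 2 ^ m), fun K x₀ R hK hKc hint hKR => ?_⟩
  have hfr : ∀ x : frontier K, ∃ b : E (m + 1), ‖(b - x₀).ofLp‖ = R ∧
      ∀ y ∈ K, inner ℝ (b - x.1) (y - x.1) ≤ 0 := by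
    intro x
    obtain ⟨ν, hν, hν'⟩ := exists_outward_vector hK hint x.2
    have hx : x.1 ∈ K := hKc.frontier_subset x.2
    obtain ⟨t, ht, htR⟩ := exists_ray_meets_cube hν (by simpa [dist_eq_norm] using hKR hx)
    refine ⟨x.1 + t • ν, htR, fun y hy => ?_⟩
    rw [add_sub_cancel_left, inner_smul_left]
    exact mul_nonpos_of_nonneg_of_nonpos (by simpa using ht) (hν' y hy)
  choose b hbR hb using hfr
  have hanti : AntilipschitzWith 1 b := by
    refine AntilipschitzWith.of_le_mul_dist fun x y => ?_
    rw [NNReal.coe_one, one_mul, Subtype.dist_eq, dist_eq_norm, dist_eq_norm]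
    have h1 := hb x y.1 (hKc.frontier_subset y.2)
    have h2 := hb y x.1 (hKc.frontier_subset x.2)
    have h3 : ‖x.1 - y.1‖ ^ 2 ≤ inner ℝ (b x - b y) (x.1 - y.1) := by
      have e : inner ℝ (b x - b y) (x.1 - y.1) - ‖x.1 - y.1‖ ^ 2
          = - inner ℝ (b x - x.1) (y.1 - x.1) - inner ℝ (b y - y.1) (x.1 - y.1) := by
        rw [← real_inner_self_eq_norm_sq]
        simp only [inner_sub_left, inner_sub_right]
        ring
      linarith
    have h4 := real_inner_le_norm (b x - b y) (x.1 - y.1)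
    rcases (norm_nonneg (x.1 - y.1)).eq_or_lt with h0 | h0
    · rw [← h0]; positivity
    · exact le_of_mul_le_mul_right (by nlinarith) h0
  have hR : 0 ≤ R := by
    obtain ⟨z, hz⟩ := hint
    exact dist_nonneg.trans (hKR (interior_subset hz))
  have hm : (0 : ℝ) ≤ (m : ℝ) := by positivity
  have hball : Measure.hausdorffMeasure (m : ℝ) (Metric.closedBall (0 : Fin m → ℝ) R)
      = ENNReal.ofReal ((2 * R) ^ m) := by
    have h1 := hausdorffMeasure_pi_real (ι := Fin m)
    rw [Fintype.card_fin] at h1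
    rw [h1, Real.volume_pi_closedBall _ hR, Fintype.card_fin]
  have hmain : Measure.hausdorffMeasure (m : ℝ) (frontier K)
      ≤ (2 * (m + 1) * L ^ m * 2 ^ m : NNReal) * ENNReal.ofReal (R ^ m) := by
    calc Measure.hausdorffMeasure (m : ℝ) (frontier K)
        = Measure.hausdorffMeasure (m : ℝ) (univ : Set (frontier K)) := by
          have h1 : Isometry (Subtype.val : frontier K → E (m + 1)) := isometry_subtype_coe
          rw [← h1.hausdorffMeasure_image (Or.inl hm), image_univ, Subtype.range_coe]
      _ ≤ Measure.hausdorffMeasure (m : ℝ) (b '' univ) := by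
          simpa using hanti.le_hausdorffMeasure_image hm univ
      _ ≤ Measure.hausdorffMeasure (m : ℝ) (⋃ p : Fin (m + 1) × Bool,
            (fun z : Fin m → ℝ => x₀ +
              (WithLp.toLp 2 (Fin.insertNth p.1 (if p.2 then R else -R) z) : E (m + 1))) ''
            Metric.closedBall 0 R) := by
          refine measure_mono (Subset.trans ?_ (cubeSphere_subset x₀ R))
          rintro _ ⟨x, -, rfl⟩
          exact hbR x
      _ ≤ ∑ p : Fin (m + 1) × Bool, Measure.hausdorffMeasure (m : ℝ)
            ((fun z : Fin m → ℝ => x₀ +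
              (WithLp.toLp 2 (Fin.insertNth p.1 (if p.2 then R else -R) z) : E (m + 1))) ''
            Metric.closedBall 0 R) := measure_iUnion_fintype_le _ _
      _ ≤ ∑ p : Fin (m + 1) × Bool, (L : ENNReal) ^ m * ENNReal.ofReal ((2 * R) ^ m) := by
          refine Finset.sum_le_sum fun p _ => ?_
          have := (hL x₀ p.1 (if p.2 then R else -R)).hausdorffMeasure_image_le hm
            (Metric.closedBall 0 R)
          rwa [hball, ENNReal.rpow_natCast] at this
      _ = _ := by
          rw [mul_pow, ENNReal.ofReal_mul (by positivity)]
          simp only [Finset.sum_const, Finset.card_univ, Fintype.card_prod, Fintype.card_fin,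
            Fintype.card_bool, nsmul_eq_mul]
          rw [ENNReal.ofReal_pow (by norm_num : (0 : ℝ) ≤ 2)]
          push_cast
          simp only [ENNReal.ofReal_ofNat]
          ring
  rw [hc, Measure.smul_apply, ENNReal.smul_def, smul_eq_mul, ENNReal.coe_mul, mul_assoc]
  gcongr

end Surface

/-! ### Gradients of polynomial vector fields -/

section PolynomialFields

variable {d k : ℕ}

theorem IsPoly.continuous {f : E d → ℝ} (hf : IsPoly k f) : Continuous f := by
  obtain ⟨P, -, hP⟩ := hf
  exact funext hP ▸ continuous_eval_coord P

theorem IsVecPoly.continuous {g : E d → E d} (hg : IsVecPoly k g) : Continuous g := by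
  have h : Continuous fun x => (g x).ofLp := continuous_pi fun j => (hg j).continuous
  exact (PiLp.continuous_toLp 2 _).comp h

theorem IsPoly.add {f₁ f₂ : E d → ℝ} (h₁ : IsPoly k f₁) (h₂ : IsPoly k f₂) :
    IsPoly k fun x => f₁ x + f₂ x := by
  obtain ⟨P, hP, hP'⟩ := h₁
  obtain ⟨Q, hQ, hQ'⟩ := h₂
  exact ⟨P + Q, (MvPolynomial.totalDegree_add _ _).trans (max_le hP hQ), fun x => by simp [hP', hQ']⟩

theorem IsPoly.const_mul {f : E d → ℝ} (hf : IsPoly k f) (a : ℝ) : IsPoly k fun x => a * f x := by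
  obtain ⟨P, hP, hP'⟩ := hf
  exact ⟨a • P, (MvPolynomial.totalDegree_smul_le _ _).trans hP, fun x => by
    simp [hP']⟩

theorem IsVecPoly.differentiable {g : E d → E d} (hg : IsVecPoly k g) : Differentiable ℝ g := by
  rw [differentiable_euclidean]
  intro j x
  obtain ⟨P, -, hP⟩ := hg j
  rw [funext hP]
  exact (hasFDerivAt_eval_coord P x).differentiableAt

theorem gradMat_univ (g : E d → E d) (x : E d) (i j : Fin d) :
    gradMat univ g x i j = fderiv ℝ g x (EuclideanSpace.single j 1) i := by
  simp [gradMat, fderivWithin_univ]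

theorem IsVecPoly.isPoly_gradMat {g : E d → E d} (hg : IsVecPoly k g) (i j : Fin d) :
    IsPoly k fun x => gradMat univ g x i j := by
  obtain ⟨P, hP, hP'⟩ := hg i
  refine ⟨MvPolynomial.pderiv j P, (totalDegree_pderiv_le j P).trans hP, fun x => ?_⟩
  have h1 : HasFDerivAt (fun y => g y i)
      ((EuclideanSpace.proj i : E d →L[ℝ] ℝ).comp (fderiv ℝ g x)) x :=
    (EuclideanSpace.proj i : E d →L[ℝ] ℝ).hasFDerivAt.comp x (hg.differentiable x).hasFDerivAt
  rw [funext hP'] at h1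
  have h2 := h1.unique (hasFDerivAt_eval_coord P x)
  have h3 := congrArg (fun L : E d →L[ℝ] ℝ => L (EuclideanSpace.single j 1)) h2
  change gradMat univ g x i j = _
  rw [gradMat_univ]
  simpa [sum_apply, Pi.single_apply] using h3

theorem symGrad_apply (Ω : Set (E d)) (u : E d → E d) (x : E d) (i j : Fin d) :
    symGrad Ω u x i j = 1 / 2 * (gradMat Ω u x i j + gradMat Ω u x j i) := by
  simp [symGrad]

theorem IsVecPoly.isPoly_symGrad {g : E d → E d} (hg : IsVecPoly k g) (i j : Fin d) :
    IsPoly k fun x => symGrad univ g x i j := by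
  simp only [symGrad_apply]
  exact ((hg.isPoly_gradMat i j).add (hg.isPoly_gradMat j i)).const_mul _

theorem IsVecPoly.continuous_fderiv {g : E d → E d} (hg : IsVecPoly k g) :
    Continuous (fderiv ℝ g) := by
  rw [continuous_clm_apply]
  intro w
  have h1 (x : E d) : fderiv ℝ g x w = ∑ j, w j • WithLp.toLp 2 (fun i => gradMat univ g x i j) := by
    conv_lhs => rw [← (EuclideanSpace.basisFun (Fin d) ℝ).sum_repr w]
    rw [map_sum]
    refine Finset.sum_congr rfl fun j _ => ?_
    ext i
    simp [gradMat_univ]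
  simp only [h1]
  refine continuous_finsetSum _ fun j _ => Continuous.fun_const_smul ?_ _
  exact (PiLp.continuous_toLp 2 _).comp (continuous_pi fun i => (hg.isPoly_gradMat i j).continuous)

end PolynomialFields

/-! ### Meshes and piecewise polynomial functions -/

section Mesh

variable {d k : ℕ} {cells : Finset (Set (E d))} {Ω : Set (E d)}

theorem IsMesh.convex (hm : IsMesh cells Ω) {K : Set (E d)} (hK : K ∈ cells) : Convex ℝ K := by
  obtain ⟨s, rfl⟩ := (hm.1 K hK).1
  exact convex_convexHull ℝ _

theorem IsMesh.isCompact (hm : IsMesh cells Ω) {K : Set (E d)} (hK : K ∈ cells) : IsCompact K := by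
  obtain ⟨s, rfl⟩ := (hm.1 K hK).1
  exact s.finite_toSet.isCompact_convexHull ℝ

theorem IsMesh.isClosed (hm : IsMesh cells Ω) {K : Set (E d)} (hK : K ∈ cells) : IsClosed K :=
  (hm.isCompact hK).isClosed

theorem IsMesh.closure_interior (hm : IsMesh cells Ω) {K : Set (E d)} (hK : K ∈ cells) :
    closure (interior K) = K := by
  rw [(hm.convex hK).closure_interior_eq_closure_of_nonempty_interior (hm.1 K hK).2,
    (hm.isClosed hK).closure_eq]

theorem IsMesh.isOpen (hm : IsMesh cells Ω) : IsOpen Ω := by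
  rw [hm.2.2]; exact isOpen_interior

theorem IsMesh.interior_subset_domain (hm : IsMesh cells Ω) {K : Set (E d)} (hK : K ∈ cells) :
    interior K ⊆ Ω := by
  rw [hm.2.2]
  exact interior_mono (subset_biUnion_of_mem (u := id) hK)

theorem IsMesh.closure_eq (hm : IsMesh cells Ω) : closure Ω = ⋃ K ∈ cells, K := by
  refine subset_antisymm ?_ (iUnion₂_subset fun K hK => ?_)
  · refine closure_minimal ?_ (cells.finite_toSet.isClosed_biUnion fun K hK => hm.isClosed hK)
    conv_lhs => rw [hm.2.2]
    exact interior_subset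
  · rw [← hm.closure_interior hK]
    exact closure_mono (hm.interior_subset_domain hK)

theorem IsMesh.isCompact_closure (hm : IsMesh cells Ω) : IsCompact (closure Ω) := by
  rw [hm.closure_eq]
  exact cells.finite_toSet.isCompact_biUnion fun K hK => hm.isCompact hK

theorem IsMesh.frontier_subset (hm : IsMesh cells Ω) :
    frontier Ω ⊆ ⋃ K ∈ cells, frontier K := by
  intro x hx
  have h1 : x ∈ ⋃ K ∈ cells, K := hm.closure_eq ▸ hx.1
  obtain ⟨K, hK, hxK⟩ := mem_iUnion₂.1 h1
  refine mem_iUnion₂.2 ⟨K, hK, subset_closure hxK, fun h => hx.2 ?_⟩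
  rw [hm.isOpen.interior_eq]
  exact hm.interior_subset_domain hK h

theorem IsMesh.eq_of_mem_interior (hm : IsMesh cells Ω) {K K' : Set (E d)} (hK : K ∈ cells)
    (hK' : K' ∈ cells) {x : E d} (hx : x ∈ interior K) (hx' : x ∈ K') : K' = K := by
  by_contra hne
  have h1 : x ∈ closure (interior K') := by rwa [hm.closure_interior hK']
  obtain ⟨y, hy, hy'⟩ := mem_closure_iff.1 h1 _ isOpen_interior hx
  exact disjoint_left.1 (hm.2.1 hK' hK hne) hy' hy

theorem IsMesh.volume_lt_top (hm : IsMesh cells Ω) : volume Ω < ⊤ :=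
  (measure_mono subset_closure).trans_lt hm.isCompact_closure.measure_lt_top

theorem IsMesh.ae_mem_interior (hm : IsMesh cells Ω) :
    ∀ᵐ x ∂(volume.restrict Ω), ∃ K ∈ cells, x ∈ interior K := by
  have h1 : volume (⋃ K ∈ cells, frontier K) = 0 :=
    (measure_biUnion_null_iff cells.countable_toSet).2 fun K hK =>
      (hm.convex hK).addHaar_frontier volume
  rw [ae_restrict_iff' hm.isOpen.measurableSet]
  filter_upwards [measure_eq_zero_iff_ae_notMem.1 h1] with x hx hxΩ
  have h2 : x ∈ ⋃ K ∈ cells, K := hm.closure_eq ▸ subset_closure hxΩ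
  obtain ⟨K, hK, hxK⟩ := mem_iUnion₂.1 h2
  refine ⟨K, hK, by_contra fun h => hx (mem_iUnion₂.2 ⟨K, hK, subset_closure hxK, h⟩)⟩

/-- The derivative within `closure Ω` is well defined up to the boundary. -/
theorem IsMesh.uniqueDiffWithinAt (hm : IsMesh cells Ω) {x : E d} (hx : x ∈ closure Ω) :
    UniqueDiffWithinAt ℝ (closure Ω) x := by
  rw [hm.closure_eq] at hx ⊢
  obtain ⟨K, hK, hxK⟩ := mem_iUnion₂.1 hx
  exact (uniqueDiffWithinAt_convex (hm.convex hK) (hm.1 K hK).2 (subset_closure hxK)).mono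
    (subset_biUnion_of_mem (u := id) hK)

theorem IsPiecewise.exists_bound {F : Type} [NormedAddCommGroup F] [MeasurableSpace F]
    {A : (E d → F) → Prop} {f : E d → F} (hf : IsPiecewise cells A f) (hm : IsMesh cells Ω)
    (hA : ∀ g, A g → Continuous g) : ∃ C, ∀ x ∈ closure Ω, ‖f x‖ ≤ C := by
  obtain ⟨-, g, hg, hfg⟩ := hf
  have h1 : ∀ K ∈ cells, ∃ C : ℝ, ∀ x ∈ K, ‖g K x‖ ≤ C := fun K hK =>
    (hm.isCompact hK).exists_bound_of_continuousOn (hA _ (hg K hK)).continuousOn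
  choose! C hC using h1
  refine ⟨∑ K ∈ cells, |C K|, fun x hx => ?_⟩
  rw [hm.closure_eq] at hx
  obtain ⟨K, hK, hxK, h⟩ := hfg x hx
  rw [h]
  exact ((hC K hK x hxK).trans (le_abs_self _)).trans
    (Finset.single_le_sum (f := fun K => |C K|) (fun _ _ => abs_nonneg _) hK)

/-- A family of polynomial fields, one for each cell, that agree with `u` on the closed cells. -/
def IsCellwise (cells : Finset (Set (E d))) (k : ℕ) (u : E d → E d) (g : Set (E d) → E d → E d) :
    Prop :=
  ∀ K ∈ cells, IsVecPoly k (g K) ∧ EqOn u (g K) K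

/-- A continuous piecewise polynomial field agrees with its polynomial pieces on closed cells. -/
theorem IsPiecewise.exists_isCellwise {u : E d → E d} (hu : IsPiecewise cells (IsVecPoly k) u)
    (hc : ContinuousOn u (closure Ω)) (hm : IsMesh cells Ω) : ∃ g, IsCellwise cells k u g := by
  obtain ⟨-, g, hg, hug⟩ := hu
  refine ⟨g, fun K hK => ⟨hg K hK, ?_⟩⟩
  have hsub : K ⊆ closure Ω := hm.closure_eq ▸ subset_biUnion_of_mem (u := id) hK
  have h1 : EqOn u (g K) (interior K) := fun x hx => by
    obtain ⟨K', hK', hxK', h⟩ := hug x (hm.closure_eq ▸ hsub (interior_subset hx))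
    rwa [hm.eq_of_mem_interior hK hK' hx hxK'] at h
  exact h1.of_subset_closure (hc.mono hsub) (hg K hK).continuous.continuousOn interior_subset
    (hm.closure_interior hK).ge

variable {u : E d → E d} {g : Set (E d) → E d → E d}

theorem IsCellwise.hasFDerivWithinAt (hg : IsCellwise cells k u g) {K : Set (E d)}
    (hK : K ∈ cells) {x : E d} (hx : x ∈ K) : HasFDerivWithinAt u (fderiv ℝ (g K) x) K x :=
  ((hg K hK).1.differentiable x).hasFDerivAt.hasFDerivWithinAt.congr (hg K hK).2 ((hg K hK).2 hx)

theorem IsCellwise.fderivWithin_eq (hg : IsCellwise cells k u g) (hm : IsMesh cells Ω)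
    {K : Set (E d)} (hK : K ∈ cells) {x : E d} (hx : x ∈ K)
    (hd : DifferentiableWithinAt ℝ u (closure Ω) x) :
    fderivWithin ℝ u (closure Ω) x = fderiv ℝ (g K) x := by
  have hsub : K ⊆ closure Ω := hm.closure_eq ▸ subset_biUnion_of_mem (u := id) hK
  exact (uniqueDiffWithinAt_convex (hm.convex hK) (hm.1 K hK).2 (subset_closure hx)).eq
    (hd.hasFDerivWithinAt.mono hsub) (hg.hasFDerivWithinAt hK hx)

/-- The points at which the derivatives of all adjacent polynomial pieces agree. -/
def agreeSet (cells : Finset (Set (E d))) (g : Set (E d) → E d → E d) : Set (E d) :=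
  {x | ∀ K ∈ cells, ∀ K' ∈ cells, x ∈ K → x ∈ K' → fderiv ℝ (g K) x = fderiv ℝ (g K') x}

/-- A continuous piecewise polynomial field is differentiable up to the boundary exactly where the
derivatives of all adjacent pieces agree. -/
theorem IsCellwise.differentiableWithinAt_iff (hg : IsCellwise cells k u g) (hm : IsMesh cells Ω)
    {x : E d} (hx : x ∈ closure Ω) :
    DifferentiableWithinAt ℝ u (closure Ω) x ↔ x ∈ agreeSet cells g := by
  rw [agreeSet, mem_ofPred_eq]
  constructor
  · intro h K hK K' hK' hxK hxK'
    rw [← hg.fderivWithin_eq hm hK hxK h, hg.fderivWithin_eq hm hK' hxK' h]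
  · intro h
    rw [hm.closure_eq] at hx ⊢
    obtain ⟨K, hK, hxK⟩ := mem_iUnion₂.1 hx
    refine HasFDerivWithinAt.differentiableWithinAt (f' := fderiv ℝ (g K) x) ?_
    have key : ∀ s : Finset (Set (E d)), s ⊆ cells →
        HasFDerivWithinAt u (fderiv ℝ (g K) x) (⋃ K' ∈ s, K') x := by
      classical
      intro s
      induction s using Finset.induction_on with
      | empty => intro _; simp
      | insert K' s _ ih =>
        intro hs
        rw [Finset.set_biUnion_insert]
        refine HasFDerivWithinAt.union ?_ (ih ((Finset.subset_insert _ _).trans hs))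
        have hK' : K' ∈ cells := hs (Finset.mem_insert_self _ _)
        by_cases hxK' : x ∈ K'
        · rw [h K hK K' hK' hxK hxK']
          exact hg.hasFDerivWithinAt hK' hxK'
        · exact .of_notMem_closure (by rwa [(hm.isClosed hK').closure_eq])
    exact key cells subset_rfl

theorem IsCellwise.gradMat_eq (hg : IsCellwise cells k u g) (hm : IsMesh cells Ω)
    {K : Set (E d)} (hK : K ∈ cells) {x : E d} (hx : x ∈ K)
    (hd : DifferentiableWithinAt ℝ u (closure Ω) x) :
    gradMat Ω u x = gradMat univ (g K) x := by
  ext i j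
  rw [gradMat_univ, ← hg.fderivWithin_eq hm hK hx hd]
  rfl

theorem gradMat_of_not_differentiable {x : E d}
    (hd : ¬ DifferentiableWithinAt ℝ u (closure Ω) x) : gradMat Ω u x = 0 := by
  ext i j
  simp [gradMat, fderivWithin_zero_of_not_differentiableWithinAt hd]

theorem IsCellwise.differentiableWithinAt_of_mem_interior (hg : IsCellwise cells k u g)
    (hm : IsMesh cells Ω) {K : Set (E d)} (hK : K ∈ cells) {x : E d} (hx : x ∈ interior K) :
    DifferentiableWithinAt ℝ u (closure Ω) x := by
  have hxΩ : x ∈ closure Ω := subset_closure (hm.interior_subset_domain hK hx)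
  rw [hg.differentiableWithinAt_iff hm hxΩ, agreeSet, mem_ofPred_eq]
  intro K₁ h₁ K₂ h₂ hx₁ hx₂
  rw [hm.eq_of_mem_interior hK h₁ hx hx₁, hm.eq_of_mem_interior hK h₂ hx hx₂]

theorem IsCellwise.symGrad_eq_of_mem_interior (hg : IsCellwise cells k u g)
    (hm : IsMesh cells Ω) {K : Set (E d)} (hK : K ∈ cells) {x : E d} (hx : x ∈ interior K) :
    symGrad Ω u x = symGrad univ (g K) x := by
  simp only [symGrad, hg.gradMat_eq hm hK (interior_subset hx)
    (hg.differentiableWithinAt_of_mem_interior hm hK hx)]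

theorem IsCellwise.frob_symGrad_le (hg : IsCellwise cells k u g) (hm : IsMesh cells Ω)
    {K : Set (E d)} (hK : K ∈ cells) {x : E d} (hx : x ∈ K) :
    frob (symGrad Ω u x) (symGrad Ω u x)
      ≤ frob (symGrad univ (g K) x) (symGrad univ (g K) x) := by
  by_cases hd : DifferentiableWithinAt ℝ u (closure Ω) x
  · simp only [symGrad, hg.gradMat_eq hm hK hx hd, le_refl]
  · have h0 : symGrad Ω u x = 0 := by simp [symGrad, gradMat_of_not_differentiable hd]
    rw [h0]
    refine le_trans (by simp [frob])
      (Finset.sum_nonneg fun i _ => Finset.sum_nonneg fun j _ => mul_self_nonneg _)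

theorem IsCellwise.measurableSet_agreeSet (hg : IsCellwise cells k u g) (hm : IsMesh cells Ω) :
    MeasurableSet (agreeSet cells g) := by
  unfold agreeSet
  simp only [ofPred_forall]
  refine cells.measurableSet_biInter fun K hK => cells.measurableSet_biInter fun K' hK' => ?_
  have h1 : MeasurableSet {x | fderiv ℝ (g K) x = fderiv ℝ (g K') x} :=
    (isClosed_eq (hg K hK).1.continuous_fderiv (hg K' hK').1.continuous_fderiv).measurableSet
  have h2 := ((hm.isClosed hK).measurableSet.compl.union
    (hm.isClosed hK').measurableSet.compl).union h1
  convert h2 using 1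
  ext x
  simp only [mem_ofPred_eq, mem_union, mem_compl_iff]
  tauto

/-- The elementwise gradient of a continuous piecewise polynomial field is measurable for every Borel
measure, including surface measures that charge the skeleton of the mesh. -/
theorem IsCellwise.aestronglyMeasurable_gradMat (hg : IsCellwise cells k u g)
    (hm : IsMesh cells Ω) {μ : Measure (E d)} {S : Set (E d)} (hS : MeasurableSet S)
    (hSΩ : S ⊆ closure Ω) (i j : Fin d) :
    AEStronglyMeasurable (fun x => gradMat Ω u x i j) (μ.restrict S) := by
  have hSu : S = ⋃ K : cells, S ∩ K.1 := by
    rw [← inter_iUnion, eq_comm, inter_eq_left]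
    intro x hx
    obtain ⟨K, hK, hxK⟩ := mem_iUnion₂.1 (hm.closure_eq ▸ hSΩ hx)
    exact mem_iUnion.2 ⟨⟨K, hK⟩, hxK⟩
  rw [hSu, aestronglyMeasurable_iUnion_iff]
  rintro ⟨K, hK⟩
  have h1 := ((((hg K hK).1.isPoly_gradMat i j).continuous).aestronglyMeasurable
    (μ := μ.restrict (S ∩ K))).indicator (hg.measurableSet_agreeSet hm)
  refine h1.congr ?_
  filter_upwards [ae_restrict_mem (hS.inter (hm.isClosed hK).measurableSet)] with x hx
  have hiff := hg.differentiableWithinAt_iff hm (hSΩ hx.1)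
  by_cases hd : DifferentiableWithinAt ℝ u (closure Ω) x
  · rw [indicator_of_mem (hiff.1 hd), hg.gradMat_eq hm hK hx.2 hd]
  · rw [indicator_of_notMem fun h => hd (hiff.2 h), gradMat_of_not_differentiable hd]
    rfl

theorem IsCellwise.exists_bound_gradMat (hg : IsCellwise cells k u g) (hm : IsMesh cells Ω)
    (i j : Fin d) : ∃ C, ∀ x ∈ closure Ω, ‖gradMat Ω u x i j‖ ≤ C := by
  have h1 : ∀ K ∈ cells, ∃ C : ℝ, ∀ x ∈ K, ‖gradMat univ (g K) x i j‖ ≤ C :=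
    fun K hK => (hm.isCompact hK).exists_bound_of_continuousOn
      ((hg K hK).1.isPoly_gradMat i j).continuous.continuousOn
  choose! C hC using h1
  have h0 : 0 ≤ ∑ K ∈ cells, |C K| := Finset.sum_nonneg fun _ _ => abs_nonneg _
  refine ⟨∑ K ∈ cells, |C K|, fun x hx => ?_⟩
  by_cases hd : DifferentiableWithinAt ℝ u (closure Ω) x
  · rw [hm.closure_eq] at hx
    obtain ⟨K, hK, hxK⟩ := mem_iUnion₂.1 hx
    rw [hg.gradMat_eq hm hK hxK hd]
    exact ((hC K hK x hxK).trans (le_abs_self _)).trans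
      (Finset.single_le_sum (f := fun K => |C K|) (fun _ _ => abs_nonneg _) hK)
  · rw [gradMat_of_not_differentiable hd]
    simpa using h0

end Mesh

/-! ### The normal field and the interface -/

section Normal

variable {d : ℕ} {Ω : Set (E d)} {x n n' : E d}

theorem IsOutwardNormal.unique (h : IsOutwardNormal Ω x n) (h' : IsOutwardNormal Ω x n') :
    n = n' := by
  obtain ⟨hn, r, hr, H⟩ := h
  obtain ⟨hn', r', hr', H'⟩ := h'
  by_contra hne
  have hlt : inner ℝ n' n < (1 : ℝ) := by
    have h1 : 0 < ‖n - n'‖ ^ 2 := by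
      have : n - n' ≠ 0 := sub_ne_zero.2 hne
      positivity
    rw [norm_sub_sq_real, hn, hn', real_inner_comm] at h1
    linarith
  -- The direction `n' - n` points into the half-space of `n` and out of that of `n'`.
  obtain ⟨t, ht, ht1, ht2⟩ : ∃ t > 0, t * ‖n' - n‖ < r ∧ t * ‖n' - n‖ < r' := by
    have h2 : 0 < ‖n' - n‖ := norm_pos_iff.2 (sub_ne_zero.2 (Ne.symm hne))
    refine ⟨min r r' / 2 / ‖n' - n‖, by positivity, ?_, ?_⟩ <;> rw [div_mul_cancel₀ _ h2.ne']
    · have := min_le_left r r'; linarith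
    · have := min_le_right r r'; linarith
  have hd : dist (x + t • (n' - n)) x = t * ‖n' - n‖ := by
    rw [dist_eq_norm, add_sub_cancel_left, norm_smul, Real.norm_of_nonneg ht.le]
  have h3 := H (x + t • (n' - n)) (by rw [Metric.mem_ball, hd]; exact ht1)
  have h4 := H' (x + t • (n' - n)) (by rw [Metric.mem_ball, hd]; exact ht2)
  rw [add_sub_cancel_left, real_inner_smul_left, inner_sub_left, real_inner_self_eq_norm_sq,
    hn] at h3
  rw [add_sub_cancel_left, real_inner_smul_left, inner_sub_left, real_inner_self_eq_norm_sq, hn',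
    real_inner_comm] at h4
  have h5 := h4.1 (h3.2 (by nlinarith))
  nlinarith

theorem IsOutwardNormal.normal_eq (h : IsOutwardNormal Ω x n) : normal Ω x = n := by
  have hex : ∃ n, IsOutwardNormal Ω x n := ⟨n, h⟩
  rw [normal, dif_pos hex]
  exact hex.choose_spec.unique h

theorem normal_eq_zero_or_norm_eq_one (Ω : Set (E d)) (x : E d) :
    normal Ω x = 0 ∨ ‖normal Ω x‖ = 1 := by
  by_cases hex : ∃ n, IsOutwardNormal Ω x n
  · obtain ⟨n, hn⟩ := hex
    exact Or.inr (hn.normal_eq ▸ hn.1)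
  · exact Or.inl (by rw [normal, dif_neg hex])

theorem norm_normal_le_one (Ω : Set (E d)) (x : E d) : ‖normal Ω x‖ ≤ 1 := by
  rcases normal_eq_zero_or_norm_eq_one Ω x with h | h <;> simp [h]

/-- Where the outward normal exists, it is locally constant along the boundary. -/
theorem IsOutwardNormal.exists_ball (h : IsOutwardNormal Ω x n) :
    ∃ r > 0, ∀ y ∈ frontier Ω ∩ Metric.ball x r, IsOutwardNormal Ω y n := by
  obtain ⟨hn, r, hr, H⟩ := h
  refine ⟨r, hr, fun y hy => ⟨hn, r - dist y x, by have := Metric.mem_ball.1 hy.2; linarith,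
    fun z hz => ?_⟩⟩
  have hcont : Continuous fun z : E d => (inner ℝ (z - x) n : ℝ) := by fun_prop
  have hy0 : (inner ℝ (y - x) n : ℝ) = 0 := by
    refine le_antisymm (not_lt.1 fun hpos => ?_) (not_lt.1 fun hneg => ?_)
    · have hopen : IsOpen (Metric.ball x r ∩ {z | 0 < (inner ℝ (z - x) n : ℝ)}) :=
        Metric.isOpen_ball.inter (isOpen_lt continuous_const hcont)
      obtain ⟨w, ⟨hw1, hw2⟩, hw3⟩ := mem_closure_iff.1 hy.1.1 _ hopen ⟨hy.2, hpos⟩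
      exact lt_asymm ((H w hw1).1 hw3) hw2
    · refine hy.1.2 (mem_interior.2 ⟨Metric.ball x r ∩ {z | (inner ℝ (z - x) n : ℝ) < 0},
        fun w hw => (H w hw.1).2 hw.2,
        Metric.isOpen_ball.inter (isOpen_lt hcont continuous_const), hy.2, hneg⟩)
  have hz' : z ∈ Metric.ball x r := by
    rw [Metric.mem_ball] at hz ⊢
    linarith [dist_triangle z y x]
  rw [H z hz']
  have e : (inner ℝ (z - x) n : ℝ) = inner ℝ (z - y) n := by
    rw [← sub_add_sub_cancel z y x, inner_add_left, hy0, add_zero]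
  rw [e]

theorem aestronglyMeasurable_normal {μ : Measure (E d)} {S : Set (E d)} (hS : MeasurableSet S)
    (hSΩ : S ⊆ frontier Ω) : AEStronglyMeasurable (normal Ω) (μ.restrict S) := by
  let U : Set (E d) :=
    ⋃₀ {V | IsOpen V ∧ ∃ n, ∀ y ∈ frontier Ω ∩ V, IsOutwardNormal Ω y n}
  have hU : IsOpen U := isOpen_sUnion fun V hV => hV.1
  have h1 : AEStronglyMeasurable (normal Ω) (μ.restrict (S ∩ U)) := by
    refine ContinuousOn.aestronglyMeasurable (fun x hx => ?_) (hS.inter hU.measurableSet)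
    obtain ⟨V, ⟨hV, n, hn⟩, hxV⟩ := hx.2
    refine (continuousWithinAt_const (b := n)).congr_of_eventuallyEq ?_
      (hn x ⟨hSΩ hx.1, hxV⟩).normal_eq
    filter_upwards [self_mem_nhdsWithin, mem_nhdsWithin_of_mem_nhds (hV.mem_nhds hxV)] with y hy hyV
    exact (hn y ⟨hSΩ hy.1, hyV⟩).normal_eq
  have h2 : AEStronglyMeasurable (normal Ω) (μ.restrict (S \ U)) := by
    refine (aestronglyMeasurable_const (b := (0 : E d))).congr ?_
    filter_upwards [ae_restrict_mem (hS.diff hU.measurableSet)] with x hx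
    have hno : ¬ ∃ n, IsOutwardNormal Ω x n := by
      rintro ⟨n, hn⟩
      obtain ⟨r, hr, H⟩ := hn.exists_ball
      exact hx.2 ⟨Metric.ball x r, ⟨Metric.isOpen_ball, n, H⟩, Metric.mem_ball_self hr⟩
    rw [normal, dif_neg hno]
  rw [← inter_union_sdiff S U, aestronglyMeasurable_union_iff]
  exact ⟨h1, h2⟩

end Normal

section Interface

variable {d : ℕ} {cells : Finset (Set (E d))} {Ω Ωf Ωp : Set (E d)}

theorem measurableSet_interfaceSet (Ωf Ωp : Set (E d)) : MeasurableSet (interfaceSet Ωf Ωp) :=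
  (isClosed_frontier.inter isClosed_frontier).measurableSet

theorem IsMesh.surface_frontier_lt_top (hm : IsMesh cells Ω) (hd : 1 ≤ d) {K : Set (E d)}
    (hK : K ∈ cells) : Measure.euclideanHausdorffMeasure (d - 1) (frontier K) < ⊤ := by
  obtain ⟨m, rfl⟩ : ∃ m, d = m + 1 := ⟨d - 1, by omega⟩
  obtain ⟨C, hC⟩ := exists_surface_le m
  obtain ⟨R, hR⟩ := (hm.isCompact hK).isBounded.subset_closedBall 0
  exact (hC K 0 R (hm.convex hK) (hm.isClosed hK) (hm.1 K hK).2 hR).trans_lt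
    (ENNReal.mul_lt_top ENNReal.coe_lt_top ENNReal.ofReal_lt_top)

theorem IsMesh.surface_interface_lt_top (hm : IsMesh cells Ωf) (hd : 1 ≤ d) :
    Measure.euclideanHausdorffMeasure (d - 1) (interfaceSet Ωf Ωp) < ⊤ :=
  (measure_mono (inter_subset_left.trans hm.frontier_subset)).trans_lt
    (measure_biUnion_lt_top cells.finite_toSet fun _ hK => hm.surface_frontier_lt_top hd hK)

end Interface

/-! ### Bounded measurable functions on a set -/

section TameOn

variable {d : ℕ} {F G : Type*} [NormedAddCommGroup F] [NormedAddCommGroup G]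
  {μ : Measure (E d)} {S : Set (E d)}

/-- `f` is almost everywhere strongly measurable and bounded on `S`. -/
def TameOn (μ : Measure (E d)) (S : Set (E d)) (f : E d → F) : Prop :=
  AEStronglyMeasurable f (μ.restrict S) ∧ ∃ C, ∀ x ∈ S, ‖f x‖ ≤ C

theorem TameOn.prodMk {f : E d → F} {g : E d → G} (hf : TameOn μ S f) (hg : TameOn μ S g) :
    TameOn μ S fun x => (f x, g x) := by
  obtain ⟨hf, C, hC⟩ := hf
  obtain ⟨hg, C', hC'⟩ := hg
  exact ⟨hf.prodMk hg, max C C', fun x hx => max_le_max (hC x hx) (hC' x hx)⟩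

theorem TameOn.comp [ProperSpace F] {f : E d → F} (hf : TameOn μ S f) {φ : F → G}
    (hφ : Continuous φ) : TameOn μ S fun x => φ (f x) := by
  obtain ⟨hf, C, hC⟩ := hf
  obtain ⟨C', hC'⟩ := (isCompact_closedBall (0 : F) C).exists_bound_of_continuousOn
    hφ.continuousOn
  exact ⟨hφ.comp_aestronglyMeasurable hf, C', fun x hx => hC' _ (by simpa using hC x hx)⟩

theorem TameOn.pi {ι : Type*} [Fintype ι] {f : E d → ι → ℝ}
    (hf : ∀ i, TameOn μ S fun x => f x i) : TameOn μ S f := by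
  choose h1 C hC using hf
  refine ⟨(aemeasurable_pi_iff.2 fun i => (h1 i).aemeasurable).aestronglyMeasurable,
    ∑ i, |C i|, fun x hx => ?_⟩
  rw [pi_norm_le_iff_of_nonneg (Finset.sum_nonneg fun _ _ => abs_nonneg _)]
  exact fun i => ((hC i x hx).trans (le_abs_self _)).trans
    (Finset.single_le_sum (f := fun i => |C i|) (fun _ _ => abs_nonneg _) (Finset.mem_univ i))

theorem TameOn.integrableOn {f : E d → F} (hf : TameOn μ S f) (hS : MeasurableSet S)
    (hμ : μ S < ⊤) : IntegrableOn f S μ := by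
  obtain ⟨h1, C, hC⟩ := hf
  exact IntegrableOn.of_bound hμ h1 C ((ae_restrict_iff' hS).2 (.of_forall hC))

theorem tameOn_normal {Ω : Set (E d)} (hS : MeasurableSet S) (hSΩ : S ⊆ frontier Ω) :
    TameOn μ S (normal Ω) :=
  ⟨aestronglyMeasurable_normal hS hSΩ, 1, fun x _ => norm_normal_le_one Ω x⟩

variable {cells : Finset (Set (E d))} {Ω : Set (E d)} {k : ℕ}

theorem IsPiecewise.tameOn_scalar {p : E d → ℝ} (hp : IsPiecewise cells (IsPoly k) p)
    (hm : IsMesh cells Ω) (hSΩ : S ⊆ closure Ω) : TameOn μ S p := by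
  obtain ⟨C, hC⟩ := hp.exists_bound hm fun _ h => h.continuous
  exact ⟨hp.1.aestronglyMeasurable, C, fun x hx => hC x (hSΩ hx)⟩

theorem IsPiecewise.tameOn_vector {v : E d → E d} (hv : IsPiecewise cells (IsVecPoly k) v)
    (hm : IsMesh cells Ω) (hSΩ : S ⊆ closure Ω) : TameOn μ S v := by
  obtain ⟨C, hC⟩ := hv.exists_bound hm fun _ h => h.continuous
  exact ⟨hv.1.aestronglyMeasurable, C, fun x hx => hC x (hSΩ hx)⟩

theorem IsCellwise.tameOn_gradMat {u : E d → E d} {g : Set (E d) → E d → E d}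
    (hg : IsCellwise cells k u g) (hm : IsMesh cells Ω) (hS : MeasurableSet S)
    (hSΩ : S ⊆ closure Ω) (i j : Fin d) : TameOn μ S fun x => gradMat Ω u x i j := by
  obtain ⟨C, hC⟩ := hg.exists_bound_gradMat hm i j
  exact ⟨hg.aestronglyMeasurable_gradMat hm hS hSΩ i j, C, fun x hx => hC x (hSΩ hx)⟩

/-- The entries of the symmetric gradient, as an element of a normed space. -/
def symGradFun (Ω : Set (E d)) (u : E d → E d) (x : E d) : Fin d → Fin d → ℝ :=
  fun i j => symGrad Ω u x i j

theorem IsCellwise.tameOn_symGradFun {u : E d → E d} {g : Set (E d) → E d → E d}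
    (hg : IsCellwise cells k u g) (hm : IsMesh cells Ω) (hS : MeasurableSet S)
    (hSΩ : S ⊆ closure Ω) : TameOn μ S (symGradFun Ω u) := by
  have h1 : TameOn μ S fun x => (fun p : Fin d × Fin d => gradMat Ω u x p.1 p.2) :=
    TameOn.pi fun p => hg.tameOn_gradMat hm hS hSΩ p.1 p.2
  have h2 := h1.comp (φ := fun A => (fun i j => 1 / 2 * (A (i, j) + A (j, i)) :
    Fin d → Fin d → ℝ)) (by fun_prop)
  convert h2 using 1
  funext x i j
  exact symGrad_apply Ω u x i j

theorem IsCellwise.tameOn_dvg {u : E d → E d} {g : Set (E d) → E d → E d}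
    (hg : IsCellwise cells k u g) (hm : IsMesh cells Ω) (hS : MeasurableSet S)
    (hSΩ : S ⊆ closure Ω) : TameOn μ S (dvg Ω u) := by
  have h1 : TameOn μ S fun x => (fun i : Fin d => gradMat Ω u x i i) :=
    TameOn.pi fun i => hg.tameOn_gradMat hm hS hSΩ i i
  exact h1.comp (φ := fun a => ∑ i, a i) (by fun_prop)

theorem continuous_frob :
    Continuous fun p : (Fin d → Fin d → ℝ) × (Fin d → Fin d → ℝ) =>
      frob (Matrix.of p.1) (Matrix.of p.2) := by
  simp only [frob, Matrix.of_apply]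
  fun_prop

theorem continuous_mulVecE :
    Continuous fun p : (Fin d → Fin d → ℝ) × E d => mulVecE (Matrix.of p.1) p.2 := by
  refine (PiLp.continuous_toLp 2 _).comp (continuous_pi fun i => ?_)
  simp only [Matrix.mulVec, dotProduct, Matrix.of_apply]
  fun_prop

end TameOn

/-! ### The discrete trace inequality -/

section Trace

variable {d k : ℕ}

theorem frob_self_eq (A : Matrix (Fin d) (Fin d) ℝ) : frob A A = ∑ i, ∑ j, A i j ^ 2 := by
  simp [frob, sq]

theorem frob_self_nonneg (A : Matrix (Fin d) (Fin d) ℝ) : 0 ≤ frob A A :=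
  Finset.sum_nonneg fun _ _ => Finset.sum_nonneg fun _ _ => mul_self_nonneg _

theorem norm_mulVecE_sq_le (A : Matrix (Fin d) (Fin d) ℝ) {n : E d} (hn : ‖n‖ ≤ 1) :
    ‖mulVecE A n‖ ^ 2 ≤ frob A A := by
  rw [EuclideanSpace.real_norm_sq_eq, frob_self_eq]
  refine Finset.sum_le_sum fun i _ => ?_
  have h1 := Finset.sum_mul_sq_le_sq_mul_sq Finset.univ (fun j => A i j) (fun j => n j)
  have h2 : ∑ j, n j ^ 2 ≤ 1 := by
    rw [← EuclideanSpace.real_norm_sq_eq]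
    exact pow_le_one₀ (norm_nonneg _) hn
  calc (mulVecE A n) i ^ 2 = (∑ j, A i j * n j) ^ 2 := rfl
    _ ≤ (∑ j, A i j ^ 2) * ∑ j, n j ^ 2 := h1
    _ ≤ (∑ j, A i j ^ 2) * 1 :=
      mul_le_mul_of_nonneg_left h2 (Finset.sum_nonneg fun _ _ => sq_nonneg _)
    _ = _ := mul_one _

/-- The scaled pointwise bound on a cell: the symmetric gradient of a polynomial field on `K` is
controlled by its mean square over an inscribed ball. -/
theorem exists_frob_le_integral_ball (d k : ℕ) (ρ : ℝ) :
    ∃ C : ℝ, 0 ≤ C ∧ ∀ g : E d → E d, IsVecPoly k g → ∀ (x₀ : E d) (r : ℝ), 0 < r →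
      ∀ y : E d, ‖y - x₀‖ ≤ ρ * r →
      frob (symGrad univ g y) (symGrad univ g y)
        ≤ C * (r ^ d)⁻¹ * ∫ x in Metric.ball x₀ r, frob (symGrad univ g x) (symGrad univ g x) := by
  obtain ⟨C, hC, h⟩ := exists_sq_eval_le_integral_ball d k ρ
  refine ⟨C, hC, fun g hg x₀ r hr y hy => ?_⟩
  have hint (i j : Fin d) : IntegrableOn (fun x => symGrad univ g x i j ^ 2)
      (Metric.ball x₀ r) :=
    (((hg.isPoly_symGrad i j).continuous.pow 2).continuousOn.integrableOn_compact
      (isCompact_closedBall x₀ r)).mono_set Metric.ball_subset_closedBall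
  simp only [frob_self_eq]
  rw [integral_finsetSum _ fun i _ => integrable_finsetSum _ fun j _ => hint i j, Finset.mul_sum]
  refine Finset.sum_le_sum fun i _ => ?_
  rw [integral_finsetSum _ fun j _ => hint i j, Finset.mul_sum]
  refine Finset.sum_le_sum fun j _ => ?_
  obtain ⟨P, hP, hP'⟩ := hg.isPoly_symGrad i j
  simp only [hP']
  exact h P hP x₀ r hr y hy

theorem IsCellwise.sum_integral_interior_le {cells : Finset (Set (E d))} {Ω : Set (E d)}
    {u : E d → E d} {g : Set (E d) → E d → E d} (hg : IsCellwise cells k u g)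
    (hm : IsMesh cells Ω) :
    ∑ K ∈ cells, ∫ x in interior K, frob (symGrad Ω u x) (symGrad Ω u x)
      ≤ ∫ x in Ω, frob (symGrad Ω u x) (symGrad Ω u x) := by
  have hT : TameOn volume Ω (symGradFun Ω u) :=
    hg.tameOn_symGradFun hm hm.isOpen.measurableSet subset_closure
  have hI : IntegrableOn (fun x => frob (symGrad Ω u x) (symGrad Ω u x)) Ω :=
    ((hT.prodMk hT).comp continuous_frob).integrableOn hm.isOpen.measurableSet hm.volume_lt_top
  have hsub : ⋃ K ∈ cells, interior K ⊆ Ω :=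
    iUnion₂_subset fun K hK => hm.interior_subset_domain hK
  rw [← integral_biUnion_finset cells (fun K _ => isOpen_interior.measurableSet) hm.2.1
    fun K hK => hI.mono_set (hm.interior_subset_domain hK)]
  exact setIntegral_mono_set hI (.of_forall fun x => frob_self_nonneg _) hsub.eventuallyLE

/-- A shape-regular, quasi-uniform family satisfies the trace inequality with a constant independent
of the mesh. On each cell the integrand is bounded by its mean over an inscribed ball of radius
comparable to `h`, and the boundary of the cell has surface measure of order `h ^ (d - 1)`. -/
theorem exists_traceInverse (hd : 1 ≤ d) (Ωf Ωp : Set (E d)) (k : ℕ) (ρ θ : ℝ) :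
    ∃ CTI : ℝ, 0 < CTI ∧ ∀ T : Discretization d, T.IsFiniteElement Ωf Ωp k → T.IsRegular ρ θ →
      T.TraceInverse Ωf Ωp CTI := by
  obtain ⟨m, rfl⟩ : ∃ m, d = m + 1 := ⟨d - 1, by omega⟩
  obtain ⟨C₁, hC₁, hinv⟩ := exists_frob_le_integral_ball (m + 1) k ρ
  obtain ⟨C₂, hsurf⟩ := exists_surface_le m
  refine ⟨|θ| * |ρ| ^ (m + 1) * C₂ * C₁ + 1, by positivity, fun T hT hreg u hu => ?_⟩
  have hm := hT.mesh_f
  obtain ⟨g, hg⟩ := (hT.vf u hu).1.exists_isCellwise (hT.vf u hu).2 hm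
  set μ : Measure (E (m + 1)) := Measure.euclideanHausdorffMeasure (m + 1 - 1)
  set Γ := interfaceSet Ωf Ωp
  have hΓm : MeasurableSet Γ := measurableSet_interfaceSet Ωf Ωp
  have hΓfin : μ Γ < ⊤ := hm.surface_interface_lt_top (by omega)
  have hΓc : Γ ⊆ closure Ωf := inter_subset_left.trans frontier_subset_closure
  let I : Set (E (m + 1)) → ℝ := fun K =>
    ∫ x in interior K, frob (symGrad Ωf u x) (symGrad Ωf u x)
  have hI0 (K) : 0 ≤ I K := setIntegral_nonneg isOpen_interior.measurableSet
    fun x _ => frob_self_nonneg _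
  have hcell : ∀ K ∈ T.meshF, ∃ M : ℝ, 0 ≤ M ∧
      (∀ x ∈ K, frob (symGrad Ωf u x) (symGrad Ωf u x) ≤ M) ∧
      T.h * (M * μ.real (frontier K)) ≤ |θ| * |ρ| ^ (m + 1) * C₂ * C₁ * I K := by
    intro K hK
    obtain ⟨⟨x₀, r, hr, hball, hdiam⟩, -, hθ⟩ := hreg.1 K hK
    have hx₀ : x₀ ∈ K := hball (Metric.mem_closedBall_self hr.le)
    have hKball : ∀ y ∈ K, ‖y - x₀‖ ≤ ρ * r := fun y hy => by
      rw [← dist_eq_norm]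
      exact (Metric.dist_le_diam_of_mem (hm.isCompact hK).isBounded hy hx₀).trans hdiam
    have hint : ∫ x in Metric.ball x₀ r, frob (symGrad univ (g K) x) (symGrad univ (g K) x)
        ≤ I K := by
      have hsub : Metric.ball x₀ r ⊆ interior K :=
        interior_maximal (Metric.ball_subset_closedBall.trans hball) Metric.isOpen_ball
      have hT' : TameOn volume (interior K) (symGradFun Ωf u) :=
        hg.tameOn_symGradFun hm isOpen_interior.measurableSet
          ((hm.interior_subset_domain hK).trans subset_closure)
      have hfin : volume (interior K) < ⊤ :=
        (measure_mono interior_subset).trans_lt (hm.isCompact hK).measure_lt_top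
      calc _ = ∫ x in Metric.ball x₀ r, frob (symGrad Ωf u x) (symGrad Ωf u x) :=
            setIntegral_congr_fun Metric.isOpen_ball.measurableSet fun x hx => by
              simp only [hg.symGrad_eq_of_mem_interior hm hK (hsub hx)]
        _ ≤ I K := setIntegral_mono_set
            (((hT'.prodMk hT').comp continuous_frob).integrableOn isOpen_interior.measurableSet hfin)
            (.of_forall fun x => frob_self_nonneg _) hsub.eventuallyLE
    refine ⟨C₁ * (r ^ (m + 1))⁻¹ * I K, by have := hI0 K; positivity, fun x hx => ?_, ?_⟩
    · refine (hg.frob_symGrad_le hm hK hx).trans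
        ((hinv (g K) (hg K hK).1 x₀ r hr x (hKball x hx)).trans ?_)
      gcongr
    · have hρr : 0 ≤ ρ * r := (norm_nonneg _).trans (hKball x₀ hx₀)
      have hρ : 0 ≤ ρ := nonneg_of_mul_nonneg_left hρr hr
      have hs : μ.real (frontier K) ≤ C₂ * (ρ * r) ^ m := by
        have h1 := hsurf K x₀ (ρ * r) (hm.convex hK) (hm.isClosed hK) (hm.1 K hK).2
          fun y hy => by simpa [dist_eq_norm] using hKball y hy
        have h2 := ENNReal.toReal_mono
          (ENNReal.mul_lt_top ENNReal.coe_lt_top ENNReal.ofReal_lt_top).ne h1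
        rwa [ENNReal.toReal_mul, ENNReal.toReal_ofReal (by positivity), ENNReal.coe_toReal] at h2
      have hh : T.h ≤ |θ| * (ρ * r) :=
        (hθ.trans (mul_le_mul_of_nonneg_right (le_abs_self θ) Metric.diam_nonneg)).trans
          (mul_le_mul_of_nonneg_left hdiam (abs_nonneg θ))
      have h0 := hI0 K
      have h1 : 0 ≤ C₁ * (r ^ (m + 1))⁻¹ * I K := by positivity
      calc T.h * (C₁ * (r ^ (m + 1))⁻¹ * I K * μ.real (frontier K))
          ≤ |θ| * (ρ * r) * (C₁ * (r ^ (m + 1))⁻¹ * I K * (C₂ * (ρ * r) ^ m)) :=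
            mul_le_mul hh (mul_le_mul_of_nonneg_left hs h1)
              (mul_nonneg h1 measureReal_nonneg) (by positivity)
        _ = |θ| * |ρ| ^ (m + 1) * C₂ * C₁ * I K := by
            rw [abs_of_nonneg hρ]
            field_simp
            ring
  choose! M hM0 hM hMK using hcell
  have hDt : TameOn μ Γ (symGradFun Ωf u) := hg.tameOn_symGradFun hm hΓm hΓc
  have hnt : TameOn μ Γ (normal Ωf) := tameOn_normal hΓm inter_subset_left
  have hfint : IntegrableOn (fun x => ‖mulVecE (symGrad Ωf u x) (normal Ωf x)‖ ^ 2) Γ μ :=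
    ((hDt.prodMk hnt).comp (continuous_mulVecE.norm.pow 2)).integrableOn hΓm hΓfin
  have hind : ∀ K ∈ T.meshF, IntegrableOn ((frontier K).indicator fun _ => M K) Γ μ :=
    fun K _ => (integrableOn_const hΓfin.ne).indicator isClosed_frontier.measurableSet
  have hbound : intΓ Ωf Ωp (fun x => ‖mulVecE (symGrad Ωf u x) (normal Ωf x)‖ ^ 2)
      ≤ ∑ K ∈ T.meshF, M K * μ.real (frontier K) := by
    calc _ ≤ ∫ x in Γ, ∑ K ∈ T.meshF, (frontier K).indicator (fun _ => M K) x ∂μ := by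
          refine setIntegral_mono_on hfint (integrable_finsetSum _ hind) hΓm fun x hx => ?_
          obtain ⟨K, hK, hxK⟩ := mem_iUnion₂.1 (hm.frontier_subset hx.1)
          have h1 : (frontier K).indicator (fun _ => M K) x = M K := indicator_of_mem hxK _
          have h2 := Finset.single_le_sum
            (f := fun K => (frontier K).indicator (fun _ => M K) x)
            (fun K hK => indicator_nonneg (fun _ _ => hM0 K hK) x) hK
          refine (norm_mulVecE_sq_le _ (norm_normal_le_one Ωf x)).trans
            ((hM K hK x ((hm.isClosed hK).frontier_subset hxK)).trans ?_)
          exact h1.symm.trans_le h2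
      _ = ∑ K ∈ T.meshF, ∫ x in Γ, (frontier K).indicator (fun _ => M K) x ∂μ :=
          integral_finsetSum _ hind
      _ ≤ _ := by
          refine Finset.sum_le_sum fun K hK => ?_
          rw [setIntegral_indicator isClosed_frontier.measurableSet, setIntegral_const, smul_eq_mul,
            mul_comm]
          refine mul_le_mul_of_nonneg_left ?_ (hM0 K hK)
          exact measureReal_mono inter_subset_right
            (hm.surface_frontier_lt_top (by omega) hK).ne
  have hsum := hg.sum_integral_interior_le hm
  have hIΩ : 0 ≤ ∫ x in Ωf, frob (symGrad Ωf u x) (symGrad Ωf u x) :=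
    integral_nonneg fun x => frob_self_nonneg _
  calc _ ≤ T.h * ∑ K ∈ T.meshF, M K * μ.real (frontier K) :=
        mul_le_mul_of_nonneg_left hbound T.h_pos.le
    _ = ∑ K ∈ T.meshF, T.h * (M K * μ.real (frontier K)) := Finset.mul_sum _ _ _
    _ ≤ ∑ K ∈ T.meshF, |θ| * |ρ| ^ (m + 1) * C₂ * C₁ * I K := Finset.sum_le_sum hMK
    _ = |θ| * |ρ| ^ (m + 1) * C₂ * C₁ * ∑ K ∈ T.meshF, I K := (Finset.mul_sum _ _ _).symm
    _ ≤ |θ| * |ρ| ^ (m + 1) * C₂ * C₁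
          * ∫ x in Ωf, frob (symGrad Ωf u x) (symGrad Ωf u x) :=
        mul_le_mul_of_nonneg_left hsum (by positivity)
    _ ≤ _ := by rw [add_mul, one_mul]; exact le_add_of_nonneg_right hIΩ

end Trace

/-! ### Linearity of the discrete gradients -/

section Linearity

variable {d k : ℕ} {cells : Finset (Set (E d))} {Ω : Set (E d)}

theorem gradMat_smul (hm : IsMesh cells Ω) (c : ℝ) (u : E d → E d) {x : E d}
    (hx : x ∈ closure Ω) : gradMat Ω (c • u) x = c • gradMat Ω u x := by
  ext i j
  simp [gradMat, fderivWithin_const_smul_field, hm.uniqueDiffWithinAt hx]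

theorem symGrad_smul (hm : IsMesh cells Ω) (c : ℝ) (u : E d → E d) {x : E d}
    (hx : x ∈ closure Ω) : symGrad Ω (c • u) x = c • symGrad Ω u x := by
  rw [symGrad, gradMat_smul hm c u hx, Matrix.transpose_smul, ← smul_add, smul_comm, symGrad]

variable {u u₀ : E d → E d} {g g₀ : Set (E d) → E d → E d}

/-- Off the mesh skeleton, the elementwise gradient commutes with difference quotients. -/
theorem gradMat_dq (hg : IsCellwise cells k u g) (hg₀ : IsCellwise cells k u₀ g₀)
    (hm : IsMesh cells Ω) (τ : ℝ) :
    ∀ᵐ x ∂(volume.restrict Ω), gradMat Ω (dq τ u u₀) x = dq τ (gradMat Ω u x) (gradMat Ω u₀ x) := by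
  filter_upwards [hm.ae_mem_interior] with x ⟨K, hK, hxK⟩
  have hx : x ∈ closure Ω := subset_closure (hm.interior_subset_domain hK hxK)
  rw [dq, gradMat_smul hm _ _ hx, dq]
  congr 1
  ext i j
  simp [gradMat, fderivWithin_sub (hm.uniqueDiffWithinAt hx)
    (hg.differentiableWithinAt_of_mem_interior hm hK hxK)
    (hg₀.differentiableWithinAt_of_mem_interior hm hK hxK)]

theorem symGrad_dq (hg : IsCellwise cells k u g) (hg₀ : IsCellwise cells k u₀ g₀)
    (hm : IsMesh cells Ω) (τ : ℝ) :
    ∀ᵐ x ∂(volume.restrict Ω), symGrad Ω (dq τ u u₀) x = dq τ (symGrad Ω u x) (symGrad Ω u₀ x) := by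
  filter_upwards [gradMat_dq hg hg₀ hm τ] with x hx
  rw [symGrad, hx]
  ext i j
  simp only [symGrad, dq, Matrix.smul_apply, Matrix.add_apply, Matrix.transpose_apply,
    Matrix.sub_apply, smul_eq_mul]
  ring

theorem dvg_dq (hg : IsCellwise cells k u g) (hg₀ : IsCellwise cells k u₀ g₀)
    (hm : IsMesh cells Ω) (τ : ℝ) :
    ∀ᵐ x ∂(volume.restrict Ω), dvg Ω (dq τ u u₀) x = dq τ (dvg Ω u x) (dvg Ω u₀ x) := by
  filter_upwards [gradMat_dq hg hg₀ hm τ] with x hx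
  rw [dvg, hx]
  simp [dvg, dq, Matrix.trace_smul, Matrix.trace_sub]

end Linearity

/-! ### The energy balance of the bulk terms -/

section Bulk

variable {d k : ℕ}

theorem inner_dq_self {V : Type} [NormedAddCommGroup V] [InnerProductSpace ℝ V] {τ : ℝ}
    (hτ : τ ≠ 0) (a b : V) :
    τ * inner ℝ (dq τ a b) a = 1 / 2 * (‖a‖ ^ 2 - ‖b‖ ^ 2 + τ ^ 2 * ‖dq τ a b‖ ^ 2) := by
  have h1 : a - b = τ • dq τ a b := by rw [dq, smul_inv_smul₀ hτ]
  have h2 : b = a - τ • dq τ a b := by rw [← h1]; abel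
  have h3 : ‖b‖ ^ 2 = ‖a‖ ^ 2 - 2 * (τ * inner ℝ (dq τ a b) a) + τ ^ 2 * ‖dq τ a b‖ ^ 2 := by
    conv_lhs => rw [h2]
    rw [norm_sub_sq_real, norm_smul, mul_pow, Real.norm_eq_abs, sq_abs, real_inner_smul_right,
      real_inner_comm]
  rw [h3]; ring

theorem mul_dq_self {τ : ℝ} (hτ : τ ≠ 0) (a b : ℝ) :
    τ * (dq τ a b * a) = 1 / 2 * (a ^ 2 - b ^ 2 + τ ^ 2 * dq τ a b ^ 2) := by
  simp only [dq, smul_eq_mul]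
  field_simp
  ring

theorem frob_dq_self {τ : ℝ} (hτ : τ ≠ 0) (A B : Matrix (Fin d) (Fin d) ℝ) :
    τ * frob A (dq τ A B)
      = 1 / 2 * (frob A A - frob B B + τ ^ 2 * frob (dq τ A B) (dq τ A B)) := by
  simp only [frob, Finset.mul_sum, ← Finset.sum_sub_distrib, ← Finset.sum_add_distrib]
  refine Finset.sum_congr rfl fun i _ => Finset.sum_congr rfl fun j _ => ?_
  simp only [dq, Matrix.smul_apply, Matrix.sub_apply, smul_eq_mul]
  field_simp
  ring

/-- Integrated form of the identity `τ (d_τ a) a = (a² - b² + τ² (d_τ a)²) / 2`. -/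
theorem integral_backwardDifference {τ : ℝ} {μ : Measure (E d)} {f a b e : E d → ℝ}
    (ha : Integrable a μ) (hb : Integrable b μ) (he : Integrable e μ)
    (h : ∀ᵐ x ∂μ, τ * f x = 1 / 2 * (a x - b x + τ ^ 2 * e x)) :
    τ * ∫ x, f x ∂μ = 1 / 2 * (∫ x, a x ∂μ - ∫ x, b x ∂μ + τ ^ 2 * ∫ x, e x ∂μ) := by
  have hab : Integrable (fun x => a x - b x) μ := ha.sub hb
  rw [← integral_const_mul, integral_congr_ae h, integral_const_mul,
    integral_add hab (he.const_mul _), integral_sub ha hb, integral_const_mul]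

theorem tameOn_dq {F : Type} [NormedAddCommGroup F] [NormedSpace ℝ F] {μ : Measure (E d)}
    {S : Set (E d)} {f f₀ : E d → F} [ProperSpace F] (hf : TameOn μ S f) (hf₀ : TameOn μ S f₀)
    (τ : ℝ) : TameOn μ S fun x => dq τ (f x) (f₀ x) :=
  (hf.prodMk hf₀).comp (φ := fun p => τ⁻¹ • (p.1 - p.2)) (by fun_prop)

variable {cells : Finset (Set (E d))} {Ω : Set (E d)} {τ : ℝ}

theorem IsPiecewise.integral_inner_dq {v v₀ : E d → E d}
    (hv : IsPiecewise cells (IsVecPoly k) v) (hv₀ : IsPiecewise cells (IsVecPoly k) v₀)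
    (hm : IsMesh cells Ω) (hτ : τ ≠ 0) :
    τ * ∫ x in Ω, inner ℝ (dq τ v v₀ x) (v x)
      = 1 / 2 * ((∫ x in Ω, ‖v x‖ ^ 2) - (∫ x in Ω, ‖v₀ x‖ ^ 2)
        + τ ^ 2 * ∫ x in Ω, ‖dq τ v v₀ x‖ ^ 2) := by
  have hS := hm.isOpen.measurableSet
  have t : TameOn volume Ω v := hv.tameOn_vector hm subset_closure
  have t₀ : TameOn volume Ω v₀ := hv₀.tameOn_vector hm subset_closure
  have hc : Continuous fun w : E d => ‖w‖ ^ 2 := by fun_prop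
  exact integral_backwardDifference ((t.comp hc).integrableOn hS hm.volume_lt_top)
    ((t₀.comp hc).integrableOn hS hm.volume_lt_top)
    (((tameOn_dq t t₀ τ).comp hc).integrableOn hS hm.volume_lt_top)
    (.of_forall fun x => inner_dq_self hτ (v x) (v₀ x))

theorem IsPiecewise.integral_mul_dq {p p₀ : E d → ℝ}
    (hp : IsPiecewise cells (IsPoly k) p) (hp₀ : IsPiecewise cells (IsPoly k) p₀)
    (hm : IsMesh cells Ω) (hτ : τ ≠ 0) :
    τ * ∫ x in Ω, dq τ p p₀ x * p x
      = 1 / 2 * ((∫ x in Ω, p x ^ 2) - (∫ x in Ω, p₀ x ^ 2)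
        + τ ^ 2 * ∫ x in Ω, dq τ p p₀ x ^ 2) := by
  have hS := hm.isOpen.measurableSet
  have t : TameOn volume Ω p := hp.tameOn_scalar hm subset_closure
  have t₀ : TameOn volume Ω p₀ := hp₀.tameOn_scalar hm subset_closure
  have hc : Continuous fun w : ℝ => w ^ 2 := by fun_prop
  exact integral_backwardDifference ((t.comp hc).integrableOn hS hm.volume_lt_top)
    ((t₀.comp hc).integrableOn hS hm.volume_lt_top)
    (((tameOn_dq t t₀ τ).comp hc).integrableOn hS hm.volume_lt_top)
    (.of_forall fun x => mul_dq_self hτ (p x) (p₀ x))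

theorem IsCellwise.integral_frob_dq {u u₀ : E d → E d} {g g₀ : Set (E d) → E d → E d}
    (hg : IsCellwise cells k u g) (hg₀ : IsCellwise cells k u₀ g₀) (hm : IsMesh cells Ω)
    (hτ : τ ≠ 0) :
    τ * ∫ x in Ω, frob (symGrad Ω u x) (symGrad Ω (dq τ u u₀) x)
      = 1 / 2 * ((∫ x in Ω, frob (symGrad Ω u x) (symGrad Ω u x))
        - (∫ x in Ω, frob (symGrad Ω u₀ x) (symGrad Ω u₀ x))
        + τ ^ 2 * ∫ x in Ω, frob (dq τ (symGrad Ω u x) (symGrad Ω u₀ x))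
            (dq τ (symGrad Ω u x) (symGrad Ω u₀ x))) := by
  have hS := hm.isOpen.measurableSet
  have t : TameOn volume Ω (symGradFun Ω u) := hg.tameOn_symGradFun hm hS subset_closure
  have t₀ : TameOn volume Ω (symGradFun Ω u₀) := hg₀.tameOn_symGradFun hm hS subset_closure
  have t₁ := tameOn_dq t t₀ τ
  refine integral_backwardDifference
    (((t.prodMk t).comp continuous_frob).integrableOn hS hm.volume_lt_top)
    (((t₀.prodMk t₀).comp continuous_frob).integrableOn hS hm.volume_lt_top)
    (((t₁.prodMk t₁).comp continuous_frob).integrableOn hS hm.volume_lt_top) ?_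
  filter_upwards [symGrad_dq hg hg₀ hm τ] with x hx
  rw [hx]
  exact frob_dq_self hτ _ _

theorem IsCellwise.integral_dvg_dq {u u₀ : E d → E d} {g g₀ : Set (E d) → E d → E d}
    (hg : IsCellwise cells k u g) (hg₀ : IsCellwise cells k u₀ g₀) (hm : IsMesh cells Ω)
    (hτ : τ ≠ 0) :
    τ * ∫ x in Ω, dvg Ω u x * dvg Ω (dq τ u u₀) x
      = 1 / 2 * ((∫ x in Ω, dvg Ω u x ^ 2) - (∫ x in Ω, dvg Ω u₀ x ^ 2)
        + τ ^ 2 * ∫ x in Ω, dq τ (dvg Ω u x) (dvg Ω u₀ x) ^ 2) := by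
  have hS := hm.isOpen.measurableSet
  have t : TameOn volume Ω (dvg Ω u) := hg.tameOn_dvg hm hS subset_closure
  have t₀ : TameOn volume Ω (dvg Ω u₀) := hg₀.tameOn_dvg hm hS subset_closure
  have hc : Continuous fun w : ℝ => w ^ 2 := by fun_prop
  refine integral_backwardDifference ((t.comp hc).integrableOn hS hm.volume_lt_top)
    ((t₀.comp hc).integrableOn hS hm.volume_lt_top)
    (((tameOn_dq t t₀ τ).comp hc).integrableOn hS hm.volume_lt_top) ?_
  filter_upwards [dvg_dq hg hg₀ hm τ] with x hx
  rw [hx, mul_comm (dvg Ω u x)]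
  exact mul_dq_self hτ _ _

/-- The inertial coupling: testing the momentum balance with `w = d_τ U` and the kinematic relation
with `d_τ U̇` eliminates `w`. -/
theorem integral_inertia {W W₀ w : E d → E d} (t : TameOn volume Ω W) (t₀ : TameOn volume Ω W₀)
    (tw : TameOn volume Ω w) (hm : IsMesh cells Ω) :
    (∫ x in Ω, inner ℝ (dq τ W W₀ x) (w x)) + (∫ x in Ω, inner ℝ (W x - w x) (dq τ W W₀ x))
      = ∫ x in Ω, inner ℝ (dq τ W W₀ x) (W x) := by
  have hS := hm.isOpen.measurableSet
  have t₁ := tameOn_dq t t₀ τ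
  have i₁ : IntegrableOn (fun x => (inner ℝ (dq τ W W₀ x) (w x) : ℝ)) Ω :=
    ((t₁.prodMk tw).comp (φ := fun p => (inner ℝ p.1 p.2 : ℝ)) (by fun_prop)).integrableOn hS
      hm.volume_lt_top
  have i₂ : IntegrableOn (fun x => (inner ℝ (W x - w x) (dq τ W W₀ x) : ℝ)) Ω :=
    (((t.prodMk tw).prodMk t₁).comp (φ := fun p => (inner ℝ (p.1.1 - p.1.2) p.2 : ℝ))
      (by fun_prop)).integrableOn hS hm.volume_lt_top
  rw [← integral_add i₁ i₂]
  refine integral_congr_ae (.of_forall fun x => ?_)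
  simp only [real_inner_comm (dq τ W W₀ x), inner_sub_right]
  ring

end Bulk

/-! ### Coercivity of the Nitsche terms -/

section Nitsche

variable {d k : ℕ}

theorem mulVecE_stress (μ : ℝ) (D : Matrix (Fin d) (Fin d) ℝ) (p : ℝ) (n : E d) :
    mulVecE (stress μ D p) n = (2 * μ) • mulVecE D n - p • n := by
  ext i
  simp [mulVecE, stress, Matrix.sub_mulVec, Matrix.smul_mulVec]

theorem mulVecE_smul (c : ℝ) (D : Matrix (Fin d) (Fin d) ℝ) (n : E d) :
    mulVecE (c • D) n = c • mulVecE D n := by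
  ext i
  simp [mulVecE, Matrix.smul_mulVec]

theorem tang_sub_smul (n : E d) (a b : ℝ) (w z : E d) :
    tang n (a • w - b • z) = a • tang n w - b • tang n z := by
  simp only [tang, inner_sub_left, real_inner_smul_left]
  module

theorem tang_zero_left (w : E d) : tang 0 w = w := by simp [tang]

theorem mulVecE_zero (D : Matrix (Fin d) (Fin d) ℝ) : mulVecE D (0 : E d) = 0 := by
  ext i
  simp [mulVecE]

/-- The normal and tangential parts of a traction are controlled by the traction. At points without a
normal, where the normal field vanishes, the traction vanishes as well. -/
theorem sq_normal_add_sq_tang_le {n : E d} (hn : n = 0 ∨ ‖n‖ = 1)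
    (D : Matrix (Fin d) (Fin d) ℝ) :
    (inner ℝ n (mulVecE D n) : ℝ) ^ 2 + ‖tang n (mulVecE D n)‖ ^ 2 ≤ ‖mulVecE D n‖ ^ 2 := by
  rcases hn with rfl | hn
  · simp [tang_zero_left, mulVecE_zero]
  · rw [tang, norm_sub_sq_real, norm_smul, mul_pow, hn, real_inner_smul_right, Real.norm_eq_abs,
      sq_abs, real_inner_comm n]
    exact le_of_eq (by ring)

/-- Pointwise coercivity of the Nitsche terms on the diagonal. The pressure contributions cancel, and
the remaining viscous ones are absorbed by Young's inequality with weight `ε h`. -/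
theorem nitsche_pointwise {n : E d} (hn : n = 0 ∨ ‖n‖ = 1) {μ γ ς h ε : ℝ} (hμ : 0 < μ)
    (hh : 0 < h) (hε : 0 < ε) (hς : 0 ≤ ς + 1) (D : Matrix (Fin d) (Fin d) ℝ) (p : ℝ)
    (J Jt : E d) :
    μ * h⁻¹ * (γ - (ς + 1) * ε⁻¹) * ((inner ℝ J n : ℝ) ^ 2 + ‖tang n Jt‖ ^ 2)
        - (ς + 1) * μ * ε * h * ‖mulVecE D n‖ ^ 2
      ≤ γ * μ * h⁻¹ * (inner ℝ J n * inner ℝ J n + inner ℝ (tang n Jt) (tang n Jt))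
        - inner ℝ n (mulVecE (stress μ D p) n) * inner ℝ J n
        - inner ℝ (tang n (mulVecE (stress μ D p) n)) (tang n Jt)
        - inner ℝ n (mulVecE (stress μ (ς • D) (-p)) n) * inner ℝ J n
        - inner ℝ (tang n (mulVecE (stress μ (ς • D) (-p)) n)) (tang n Jt) := by
  have hsq := sq_normal_add_sq_tang_le hn D
  simp only [mulVecE_stress, mulVecE_smul, smul_smul, tang_sub_smul, inner_sub_left,
    inner_sub_right, real_inner_smul_left, real_inner_smul_right, real_inner_self_eq_norm_sq]
  set X : ℝ := inner ℝ n (mulVecE D n)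
  set Y := tang n (mulVecE D n)
  set a : ℝ := inner ℝ J n
  set b := tang n Jt
  have h1 : 2 * (X * a) ≤ ε * h * X ^ 2 + ε⁻¹ * h⁻¹ * a ^ 2 := by
    have e : ε * h * X ^ 2 + ε⁻¹ * h⁻¹ * a ^ 2 - 2 * (X * a)
        = (ε * h)⁻¹ * (ε * h * X - a) ^ 2 := by field_simp; ring
    have : 0 ≤ (ε * h)⁻¹ * (ε * h * X - a) ^ 2 := by positivity
    linarith
  have h2 : 2 * (inner ℝ Y b : ℝ) ≤ ε * h * ‖Y‖ ^ 2 + ε⁻¹ * h⁻¹ * ‖b‖ ^ 2 := by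
    have h3 : (inner ℝ Y b : ℝ) ≤ ‖Y‖ * ‖b‖ := real_inner_le_norm Y b
    have e : ε * h * ‖Y‖ ^ 2 + ε⁻¹ * h⁻¹ * ‖b‖ ^ 2 - 2 * (‖Y‖ * ‖b‖)
        = (ε * h)⁻¹ * (ε * h * ‖Y‖ - ‖b‖) ^ 2 := by field_simp; ring
    have : 0 ≤ (ε * h)⁻¹ * (ε * h * ‖Y‖ - ‖b‖) ^ 2 := by positivity
    linarith
  have h4 : ε * h * (X ^ 2 + ‖Y‖ ^ 2) ≤ ε * h * ‖mulVecE D n‖ ^ 2 :=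
    mul_le_mul_of_nonneg_left hsq (by positivity)
  have h5 : 2 * (X * a) + 2 * (inner ℝ Y b : ℝ)
      ≤ ε * h * ‖mulVecE D n‖ ^ 2 + ε⁻¹ * h⁻¹ * (a ^ 2 + ‖b‖ ^ 2) := by linarith
  have h6 := mul_le_mul_of_nonneg_left h5 (mul_nonneg hς hμ.le)
  linarith

variable {cells : Finset (Set (E d))} {Ωf Ωp : Set (E d)}

/-- Coercivity of the Nitsche terms tested with the discrete velocities themselves. -/
theorem nitsche_ge (hd : 1 ≤ d) (hm : IsMesh cells Ωf) (P : Physical) {γ ς h ε : ℝ} (hh : 0 < h)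
    (hε : 0 < ε) (hς : 0 ≤ ς + 1) {v q w : E d → E d} {p : E d → ℝ}
    {g : Set (E d) → E d → E d} (hg : IsCellwise cells k v g)
    (tv : TameOn (Measure.euclideanHausdorffMeasure (d - 1)) (interfaceSet Ωf Ωp) v)
    (tp : TameOn (Measure.euclideanHausdorffMeasure (d - 1)) (interfaceSet Ωf Ωp) p)
    (tq : TameOn (Measure.euclideanHausdorffMeasure (d - 1)) (interfaceSet Ωf Ωp) q)
    (tw : TameOn (Measure.euclideanHausdorffMeasure (d - 1)) (interfaceSet Ωf Ωp) w) :
    P.μf * h⁻¹ * (γ - (ς + 1) * ε⁻¹) *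
        (intΓ Ωf Ωp (fun x => (inner ℝ (v x - q x - w x) (normal Ωf x) : ℝ) ^ 2)
          + intΓ Ωf Ωp (fun x => ‖tang (normal Ωf x) (v x - w x)‖ ^ 2))
      - (ς + 1) * P.μf * ε * h *
        intΓ Ωf Ωp (fun x => ‖mulVecE (symGrad Ωf v x) (normal Ωf x)‖ ^ 2)
      ≤ nitscheI Ωf Ωp P γ h v p q w v q w + nitscheS Ωf Ωp P ς v q w v p := by
  set μ : Measure (E d) := Measure.euclideanHausdorffMeasure (d - 1)
  set Γ := interfaceSet Ωf Ωp
  have hΓm : MeasurableSet Γ := measurableSet_interfaceSet Ωf Ωp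
  have hΓfin : μ Γ < ⊤ := hm.surface_interface_lt_top hd
  have hΓc : Γ ⊆ closure Ωf := inter_subset_left.trans frontier_subset_closure
  have tn : TameOn μ Γ (normal Ωf) := tameOn_normal hΓm inter_subset_left
  have tD : TameOn μ Γ fun x => mulVecE (symGrad Ωf v x) (normal Ωf x) :=
    ((hg.tameOn_symGradFun hm hΓm hΓc).prodMk tn).comp continuous_mulVecE
  have tσ (c : ℝ) : TameOn μ Γ fun x =>
      mulVecE (stress P.μf (c • symGrad Ωf v x) (p x)) (normal Ωf x) := by
    simp only [mulVecE_stress, mulVecE_smul]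
    exact ((tD.prodMk tp).prodMk tn).comp
      (φ := fun y => (2 * P.μf) • c • y.1.1 - y.1.2 • y.2) (by fun_prop)
  have tσ' (c : ℝ) : TameOn μ Γ fun x =>
      mulVecE (stress P.μf (c • symGrad Ωf v x) (- p x)) (normal Ωf x) := by
    simp only [mulVecE_stress, mulVecE_smul]
    exact ((tD.prodMk tp).prodMk tn).comp
      (φ := fun y => (2 * P.μf) • c • y.1.1 - (- y.1.2) • y.2) (by fun_prop)
  have tJ : TameOn μ Γ fun x => (inner ℝ (v x - q x - w x) (normal Ωf x) : ℝ) :=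
    (((tv.prodMk tq).prodMk tw).prodMk tn).comp
      (φ := fun y => (inner ℝ (y.1.1.1 - y.1.1.2 - y.1.2) y.2 : ℝ)) (by fun_prop)
  have htang : Continuous fun y : E d × E d => tang y.1 y.2 := by unfold tang; fun_prop
  have tJt : TameOn μ Γ fun x => tang (normal Ωf x) (v x - w x) :=
    (tn.prodMk ((tv.prodMk tw).comp (φ := fun y => y.1 - y.2) (by fun_prop))).comp htang
  have tN {f : E d → E d} (tf : TameOn μ Γ f) : IntegrableOn (fun x =>
      (inner ℝ (normal Ωf x) (f x) : ℝ) * inner ℝ (v x - q x - w x) (normal Ωf x)) Γ μ :=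
    (((tn.prodMk tf).prodMk tJ).comp (φ := fun y => (inner ℝ y.1.1 y.1.2 : ℝ) * y.2)
      (by fun_prop)).integrableOn hΓm hΓfin
  have tT {f : E d → E d} (tf : TameOn μ Γ f) : IntegrableOn (fun x =>
      (inner ℝ (tang (normal Ωf x) (f x)) (tang (normal Ωf x) (v x - w x)) : ℝ)) Γ μ :=
    ((((tn.prodMk tf).comp htang).prodMk tJt).comp (φ := fun y => (inner ℝ y.1 y.2 : ℝ))
      (by fun_prop)).integrableOn hΓm hΓfin
  have iJ : IntegrableOn (fun x => (inner ℝ (v x - q x - w x) (normal Ωf x) : ℝ) ^ 2) Γ μ :=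
    (tJ.comp (φ := fun y => y ^ 2) (by fun_prop)).integrableOn hΓm hΓfin
  have iJt : IntegrableOn (fun x => ‖tang (normal Ωf x) (v x - w x)‖ ^ 2) Γ μ :=
    (tJt.comp (φ := fun y => ‖y‖ ^ 2) (by fun_prop)).integrableOn hΓm hΓfin
  have iD : IntegrableOn (fun x => ‖mulVecE (symGrad Ωf v x) (normal Ωf x)‖ ^ 2) Γ μ :=
    (tD.comp (φ := fun y => ‖y‖ ^ 2) (by fun_prop)).integrableOn hΓm hΓfin
  have iP : IntegrableOn (fun x => γ * P.μf * h⁻¹ *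
      (inner ℝ (v x - q x - w x) (normal Ωf x) * inner ℝ (v x - q x - w x) (normal Ωf x)
        + inner ℝ (tang (normal Ωf x) (v x - w x)) (tang (normal Ωf x) (v x - w x)))) Γ μ :=
    ((tJ.prodMk tJt).comp (φ := fun y => γ * P.μf * h⁻¹ * (y.1 * y.1 + inner ℝ y.2 y.2))
      (by fun_prop)).integrableOn hΓm hΓfin
  have tσ1 := tσ 1
  simp only [one_smul] at tσ1
  have hS : nitscheS Ωf Ωp P ς v q w v p =
      - (∫ x in Γ, inner ℝ (normal Ωf x)
          (mulVecE (stress P.μf (ς • symGrad Ωf v x) (- p x)) (normal Ωf x))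
        * inner ℝ (v x - q x - w x) (normal Ωf x) ∂μ)
      - ∫ x in Γ, inner ℝ (tang (normal Ωf x)
          (mulVecE (stress P.μf (ς • symGrad Ωf v x) (- p x)) (normal Ωf x)))
        (tang (normal Ωf x) (v x - w x)) ∂μ := by
    unfold nitscheS intΓ
    congr 1
    · congr 1
      refine setIntegral_congr_fun hΓm fun x hx => ?_
      simp only [symGrad_smul hm ς v (hΓc hx)]
    · refine setIntegral_congr_fun hΓm fun x hx => ?_
      simp only [symGrad_smul hm ς v (hΓc hx)]
  have iA := tN tσ1
  have iB := tT tσ1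
  have iA' := tN (tσ' ς)
  have iB' := tT (tσ' ς)
  have hmono := setIntegral_mono_on (μ := μ) (s := Γ)
    (((iJ.add iJt).const_mul (P.μf * h⁻¹ * (γ - (ς + 1) * ε⁻¹))).sub
      (iD.const_mul ((ς + 1) * P.μf * ε * h)))
    ((((iP.sub iA).sub iB).sub iA').sub iB') hΓm
    (fun x _ => nitsche_pointwise (normal_eq_zero_or_norm_eq_one Ωf x) P.μf_pos hh hε hς
      (symGrad Ωf v x) (p x) (v x - q x - w x) (v x - w x))
  rw [integral_sub' (((iP.sub iA).sub iB).sub iA') iB', integral_sub' ((iP.sub iA).sub iB) iA',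
    integral_sub' (iP.sub iA) iB, integral_sub' iP iA,
    integral_sub' ((iJ.add iJt).const_mul (P.μf * h⁻¹ * (γ - (ς + 1) * ε⁻¹)))
      (iD.const_mul ((ς + 1) * P.μf * ε * h)), integral_const_mul, integral_const_mul,
    integral_add' iJ iJt] at hmono
  rw [hS]
  unfold nitscheI intΓ
  refine hmono.trans (le_of_eq ?_)
  ring

end Nitsche

/-! ### The energy estimate -/

section Energy

variable {d k : ℕ} {Ωf Ωp : Set (E d)}

/-- The test functions that produce the energy balance: the discrete solution itself, with the
difference quotients of displacement and structure velocity. -/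
def energyTest (τ : ℝ) (y y₀ : State d) : State d where
  v := y.v
  pf := y.pf
  q := y.q
  pp := y.pp
  U := dq τ y.U y₀.U
  Udot := dq τ y.Udot y₀.Udot

theorem Discretization.Has.energyTest {T : Discretization d} {y y₀ : State d} (hy : T.Has y)
    (hy₀ : T.Has y₀) (τ : ℝ) : T.Has (energyTest τ y y₀) :=
  ⟨hy.1, hy.2.1, hy.2.2.1, hy.2.2.2.1,
    T.Xp.smul_mem _ (T.Xp.sub_mem hy.2.2.2.2.1 hy₀.2.2.2.2.1),
    T.Xdot.smul_mem _ (T.Xdot.sub_mem hy.2.2.2.2.2 hy₀.2.2.2.2.2)⟩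

/-- The energy balance: the mixed terms `b_s`, `b_p`, `b_f` cancel, and the difference quotients
produce energy increments and numerical dissipation. -/
theorem dipForm_energyTest {T : Discretization d} (hT : T.IsFiniteElement Ωf Ωp k) (P : Physical)
    {γ ς τ : ℝ} (hτ : τ ≠ 0) {y y₀ : State d} (hy : T.Has y) (hy₀ : T.Has y₀) :
    τ * dipForm Ωf Ωp P γ ς T.h τ y y₀ (energyTest τ y y₀)
      = energyF Ωf P y + energyP Ωp P y - (energyF Ωf P y₀ + energyP Ωp P y₀)
        + τ ^ 2 / 2 *
          (P.ρf * (∫ x in Ωf, ‖dq τ y.v y₀.v x‖ ^ 2)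
            + P.ρp * (∫ x in Ωp, ‖dq τ y.Udot y₀.Udot x‖ ^ 2)
            + 2 * P.μp * (∫ x in Ωp, frob (dq τ (symGrad Ωp y.U x) (symGrad Ωp y₀.U x))
                (dq τ (symGrad Ωp y.U x) (symGrad Ωp y₀.U x)))
            + P.s₀ * (∫ x in Ωp, dq τ y.pp y₀.pp x ^ 2)
            + P.lam * (∫ x in Ωp, dq τ (dvg Ωp y.U x) (dvg Ωp y₀.U x) ^ 2))
        + τ * (P.κ⁻¹ * (∫ x in Ωp, ‖y.q x‖ ^ 2)
          + 2 * P.μf * (∫ x in Ωf, frob (symGrad Ωf y.v x) (symGrad Ωf y.v x))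
          + (nitscheI Ωf Ωp P γ T.h y.v y.pf y.q (dq τ y.U y₀.U) y.v y.q (dq τ y.U y₀.U)
            + nitscheS Ωf Ωp P ς y.v y.q (dq τ y.U y₀.U) y.v y.pf)) := by
  obtain ⟨hv, -, -, hpp, hU, hW⟩ := hy
  obtain ⟨hv₀, -, -, hpp₀, hU₀, hW₀⟩ := hy₀
  have hmf := hT.mesh_f
  have hmp := hT.mesh_p
  obtain ⟨g, hg⟩ := (hT.xp _ hU).1.exists_isCellwise (hT.xp _ hU).2 hmp
  obtain ⟨g₀, hg₀⟩ := (hT.xp _ hU₀).1.exists_isCellwise (hT.xp _ hU₀).2 hmp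
  have e₁ := (hT.vf _ hv).1.integral_inner_dq (hT.vf _ hv₀).1 hmf hτ
  have e₂ := (hT.xdot _ hW).integral_inner_dq (hT.xdot _ hW₀) hmp hτ
  have e₃ := (hT.qp _ hpp).integral_mul_dq (hT.qp _ hpp₀) hmp hτ
  have e₄ := hg.integral_frob_dq hg₀ hmp hτ
  have e₅ := hg.integral_dvg_dq hg₀ hmp hτ
  have tU : TameOn volume Ωp y.U := (hT.xp _ hU).1.tameOn_vector hmp subset_closure
  have tU₀ : TameOn volume Ωp y₀.U := (hT.xp _ hU₀).1.tameOn_vector hmp subset_closure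
  have tW : TameOn volume Ωp y.Udot := (hT.xdot _ hW).tameOn_vector hmp subset_closure
  have tW₀ : TameOn volume Ωp y₀.Udot := (hT.xdot _ hW₀).tameOn_vector hmp subset_closure
  have tdU : TameOn volume Ωp (dq τ y.U y₀.U) := tameOn_dq tU tU₀ τ
  have e₆ := integral_inertia (τ := τ) tW tW₀ tdU hmp
  have e₇ : aP Ωp P y.q y.q = P.κ⁻¹ * ∫ x in Ωp, ‖y.q x‖ ^ 2 := by
    rw [aP, integral_const_mul]
    simp only [real_inner_self_eq_norm_sq]
  simp only [dipForm, energyTest, energyF, energyP, aS, aF, e₇]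
  linear_combination P.ρf * e₁ + P.ρp * e₂ + P.s₀ * e₃ + 2 * P.μp * e₄ + P.lam * e₅
    + τ * P.ρp * e₆

/-- Young's inequality for the forcing, with weight `ε μ`. -/
theorem mul_sqrt_le {ε μ D a : ℝ} (hε : 0 < ε) (hμ : 0 < μ) (hD : 0 ≤ D) :
    a * Real.sqrt D ≤ ε / 2 * (2 * μ * D) + (2 * ε)⁻¹ / (2 * μ) * a ^ 2 := by
  have h1 : ε / 2 * (2 * μ * D) + (2 * ε)⁻¹ / (2 * μ) * a ^ 2 - a * Real.sqrt D
      = (4 * ε * μ)⁻¹ * (2 * ε * μ * Real.sqrt D - a) ^ 2 := by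
    conv_lhs => rw [← Real.sq_sqrt hD, Real.sqrt_sq (Real.sqrt_nonneg D)]
    field_simp
    ring
  have h2 : 0 ≤ (4 * ε * μ)⁻¹ * (2 * ε * μ * Real.sqrt D - a) ^ 2 := by positivity
  linarith

/-- The energy estimate over one time step. -/
theorem energy_step (hd : 1 ≤ d) {T : Discretization d} (hT : T.IsFiniteElement Ωf Ωp k)
    (P : Physical) {CTI ς εhat εcheck γ c C τ Fv a : ℝ} (hCTI : 0 < CTI)
    (htr : T.TraceInverse Ωf Ωp CTI) (hς : 0 ≤ ς + 1) (hεhat : 0 < εhat) (hεcheck : 0 < εcheck)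
    (hc₁ : c < 1 - (ς + 1) / 2 * εhat * CTI - εcheck / 2)
    (hc₂ : c < γ - (ς + 1) * εhat⁻¹) (hC : (2 * εcheck)⁻¹ < C) (hτ : 0 < τ) {y y₀ : State d}
    (hy : T.Has y) (hy₀ : T.Has y₀)
    (hF : Fv ≤ a * Real.sqrt (∫ x in Ωf, frob (symGrad Ωf y.v x) (symGrad Ωf y.v x)))
    (heq : dipForm Ωf Ωp P γ ς T.h τ y y₀ (energyTest τ y y₀) = Fv) :
    energyF Ωf P y + energyP Ωp P y + c * (τ * dissipation Ωf Ωp P T.h τ y y₀)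
      ≤ energyF Ωf P y₀ + energyP Ωp P y₀ + τ * (C / P.μf * a ^ 2) := by
  have hbal := dipForm_energyTest (γ := γ) (ς := ς) hT P hτ.ne' hy hy₀
  rw [heq] at hbal
  have hmf := hT.mesh_f
  have hmp := hT.mesh_p
  have hμ := P.μf_pos
  have hh := T.h_pos
  have hΓf : interfaceSet Ωf Ωp ⊆ closure Ωf := inter_subset_left.trans frontier_subset_closure
  have hΓp : interfaceSet Ωf Ωp ⊆ closure Ωp := inter_subset_right.trans frontier_subset_closure
  obtain ⟨hv, hpf, hq, -, hU, -⟩ := hy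
  have hU₀ := hy₀.2.2.2.2.1
  obtain ⟨g, hg⟩ := (hT.vf _ hv).1.exists_isCellwise (hT.vf _ hv).2 hmf
  have hnit := nitsche_ge (Ωp := Ωp) hd hmf P (γ := γ) hh hεhat hς hg
    ((hT.vf _ hv).1.tameOn_vector hmf hΓf) ((hT.qf _ hpf).tameOn_scalar hmf hΓf)
    ((hT.vp _ hq).1.tameOn_vector hmp hΓp)
    (tameOn_dq ((hT.xp _ hU).1.tameOn_vector hmp hΓp) ((hT.xp _ hU₀).1.tameOn_vector hmp hΓp) τ)
  change P.μf * T.h⁻¹ * (γ - (ς + 1) * εhat⁻¹) *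
        (intΓ Ωf Ωp (fun x =>
            (inner ℝ (y.v x - y.q x - dq τ y.U y₀.U x) (normal Ωf x) : ℝ) ^ 2)
          + intΓ Ωf Ωp (fun x => ‖tang (normal Ωf x) (y.v x - dq τ y.U y₀.U x)‖ ^ 2))
      - (ς + 1) * P.μf * εhat * T.h *
        intΓ Ωf Ωp (fun x => ‖mulVecE (symGrad Ωf y.v x) (normal Ωf x)‖ ^ 2)
      ≤ nitscheI Ωf Ωp P γ T.h y.v y.pf y.q (dq τ y.U y₀.U) y.v y.q (dq τ y.U y₀.U)
        + nitscheS Ωf Ωp P ς y.v y.q (dq τ y.U y₀.U) y.v y.pf at hnit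
  have htrv := htr y.v hv
  have hD0 : 0 ≤ ∫ x in Ωf, frob (symGrad Ωf y.v x) (symGrad Ωf y.v x) :=
    integral_nonneg fun x => frob_self_nonneg _
  have hY := mul_sqrt_le (a := a) hεcheck hμ hD0
  have hJ0 : 0 ≤ intΓ Ωf Ωp (fun x =>
        (inner ℝ (y.v x - y.q x - dq τ y.U y₀.U x) (normal Ωf x) : ℝ) ^ 2)
      + intΓ Ωf Ωp (fun x => ‖tang (normal Ωf x) (y.v x - dq τ y.U y₀.U x)‖ ^ 2) :=
    add_nonneg (integral_nonneg fun x => sq_nonneg _) (integral_nonneg fun x => sq_nonneg _)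
  have hQ0 : 0 ≤ ∫ x in Ωp, ‖y.q x‖ ^ 2 := integral_nonneg fun x => sq_nonneg _
  have hVd : 0 ≤ ∫ x in Ωf, ‖dq τ y.v y₀.v x‖ ^ 2 := integral_nonneg fun x => sq_nonneg _
  have hWd : 0 ≤ ∫ x in Ωp, ‖dq τ y.Udot y₀.Udot x‖ ^ 2 := integral_nonneg fun x => sq_nonneg _
  have hSd : 0 ≤ ∫ x in Ωp, frob (dq τ (symGrad Ωp y.U x) (symGrad Ωp y₀.U x))
      (dq τ (symGrad Ωp y.U x) (symGrad Ωp y₀.U x)) := integral_nonneg fun x => frob_self_nonneg _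
  have hPd : 0 ≤ ∫ x in Ωp, dq τ y.pp y₀.pp x ^ 2 := integral_nonneg fun x => sq_nonneg _
  have hLd : 0 ≤ ∫ x in Ωp, dq τ (dvg Ωp y.U x) (dvg Ωp y₀.U x) ^ 2 :=
    integral_nonneg fun x => sq_nonneg _
  unfold dissipation
  set NI := nitscheI Ωf Ωp P γ T.h y.v y.pf y.q (dq τ y.U y₀.U) y.v y.q (dq τ y.U y₀.U)
  set NS := nitscheS Ωf Ωp P ς y.v y.q (dq τ y.U y₀.U) y.v y.pf
  set DΓ := intΓ Ωf Ωp (fun x => ‖mulVecE (symGrad Ωf y.v x) (normal Ωf x)‖ ^ 2)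
  set J := intΓ Ωf Ωp (fun x =>
        (inner ℝ (y.v x - y.q x - dq τ y.U y₀.U x) (normal Ωf x) : ℝ) ^ 2)
      + intΓ Ωf Ωp (fun x => ‖tang (normal Ωf x) (y.v x - dq τ y.U y₀.U x)‖ ^ 2)
  set D := ∫ x in Ωf, frob (symGrad Ωf y.v x) (symGrad Ωf y.v x)
  set Q := ∫ x in Ωp, ‖y.q x‖ ^ 2
  set Vd := ∫ x in Ωf, ‖dq τ y.v y₀.v x‖ ^ 2
  set Wd := ∫ x in Ωp, ‖dq τ y.Udot y₀.Udot x‖ ^ 2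
  set Sd := ∫ x in Ωp, frob (dq τ (symGrad Ωp y.U x) (symGrad Ωp y₀.U x))
      (dq τ (symGrad Ωp y.U x) (symGrad Ωp y₀.U x))
  set Pd := ∫ x in Ωp, dq τ y.pp y₀.pp x ^ 2
  set Ld := ∫ x in Ωp, dq τ (dvg Ωp y.U x) (dvg Ωp y₀.U x) ^ 2
  have hκ := P.κ_pos
  have hρf := P.ρf_pos
  have hρp := P.ρp_pos
  have hμp := P.μp_pos
  have hs₀ := P.s₀_pos
  have hlam := P.lam_nonneg
  have hc1 : c ≤ 1 := by
    have : 0 ≤ (ς + 1) / 2 * εhat * CTI := by positivity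
    linarith
  have k₁ : c * (2 * P.μf * D) ≤ (1 - (ς + 1) / 2 * εhat * CTI - εcheck / 2) * (2 * P.μf * D) :=
    mul_le_mul_of_nonneg_right hc₁.le (by positivity)
  have k₂ : c * (P.κ⁻¹ * Q) ≤ 1 * (P.κ⁻¹ * Q) := mul_le_mul_of_nonneg_right hc1 (by positivity)
  have k₃ : c * (P.ρf * Vd + 2 * P.μp * Sd + P.s₀ * Pd + P.lam * Ld)
      ≤ 1 * (P.ρf * Vd + 2 * P.μp * Sd + P.s₀ * Pd + P.lam * Ld) :=
    mul_le_mul_of_nonneg_right hc1 (by positivity)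
  have k₄ : c * (P.μf * T.h⁻¹ * J) ≤ (γ - (ς + 1) * εhat⁻¹) * (P.μf * T.h⁻¹ * J) :=
    mul_le_mul_of_nonneg_right hc₂.le (by positivity)
  have k₅ : (2 * εcheck)⁻¹ / (2 * P.μf) * a ^ 2 ≤ C / P.μf * a ^ 2 := by
    refine mul_le_mul_of_nonneg_right ?_ (sq_nonneg a)
    exact div_le_div₀ ((by positivity : 0 ≤ (2 * εcheck)⁻¹).trans hC.le) hC.le hμ (by linarith)
  have k₆ : (ς + 1) * P.μf * εhat * (T.h * DΓ) ≤ (ς + 1) * P.μf * εhat * (CTI * D) :=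
    mul_le_mul_of_nonneg_left htrv (by positivity)
  have k₇ : 0 ≤ P.ρp * Wd := by positivity
  -- The rate of dissipation is bounded by the Nitsche terms, the viscous terms and the forcing.
  have hrate : c * (2 * P.μf * D + P.κ⁻¹ * Q + P.μf * T.h⁻¹ * J) - C / P.μf * a ^ 2
      ≤ P.κ⁻¹ * Q + 2 * P.μf * D + (NI + NS) - Fv := by linarith
  have hrateτ := mul_le_mul_of_nonneg_left hrate hτ.le
  have hnum := mul_le_mul_of_nonneg_left
    (show c * (P.ρf * Vd + 2 * P.μp * Sd + P.s₀ * Pd + P.lam * Ld)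
      ≤ P.ρf * Vd + P.ρp * Wd + 2 * P.μp * Sd + P.s₀ * Pd + P.lam * Ld by linarith)
    (by positivity : 0 ≤ τ ^ 2 / 2)
  linarith

/-- The energy estimate, by summation of the one-step estimate. -/
theorem energyStable_of_traceInverse (hd : 1 ≤ d) {ι : Type*} {T : ι → Discretization d}
    (hT : ∀ i, (T i).IsFiniteElement Ωf Ωp k) {CTI ς εhat εcheck γ c C : ℝ} (hCTI : 0 < CTI)
    (htr : ∀ i, (T i).TraceInverse Ωf Ωp CTI) (hς : 0 ≤ ς + 1) (hεhat : 0 < εhat)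
    (hεcheck : 0 < εcheck) (hc₁ : c < 1 - (ς + 1) / 2 * εhat * CTI - εcheck / 2)
    (hc₂ : c < γ - (ς + 1) * εhat⁻¹) (hC : (2 * εcheck)⁻¹ < C) :
    EnergyStable T Ωf Ωp γ ς c C := by
  intro i P τ N F nF y hτ hF ⟨hy, hsol⟩
  have key : ∀ M ≤ N, energyF Ωf P (y M) + energyP Ωp P (y M)
        + c * (τ * ∑ n ∈ Finset.Icc 1 M, dissipation Ωf Ωp P (T i).h τ (y n) (y (n - 1)))
      ≤ energyF Ωf P (y 0) + energyP Ωp P (y 0)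
        + τ * ∑ n ∈ Finset.Icc 1 M, C / P.μf * nF n ^ 2 := by
    intro M
    induction M with
    | zero => intro _; simp
    | succ M ih =>
      intro hM
      have hmem : M + 1 ∈ Finset.Icc 1 N := Finset.mem_Icc.2 ⟨by omega, hM⟩
      have hyM := hy (M + 1) hM
      have hyM₀ := hy M (by omega)
      have hz := hyM.energyTest hyM₀ τ
      have hstep := energy_step hd (hT i) P hCTI (htr i) hς hεhat hεcheck hc₁ hc₂ hC hτ hyM hyM₀
        (hF (M + 1) hmem ⟨(y (M + 1)).v, hyM.1⟩) (hsol (M + 1) hmem _ hz)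
      rw [Finset.sum_Icc_succ_top (by omega), Finset.sum_Icc_succ_top (by omega)]
      have := ih (by omega)
      simp only [Nat.add_sub_cancel]
      linarith
  exact key N le_rfl

end Energy

end StokesBiot

end

theorem theorem1 {d : ℕ} (hd : 2 ≤ d) (Ωf Ωp : Set (StokesBiot.E d)) (hdisj : Disjoint Ωf Ωp)
    {ι : Type*} (T : ι → StokesBiot.Discretization d) (k : ℕ) (ρ θ : ℝ)
    (hfe : ∀ i, (T i).IsFiniteElement Ωf Ωp k) (hreg : ∀ i, (T i).IsRegular ρ θ) :
    (∃ CTI : ℝ, 0 < CTI ∧ ∀ i, (T i).TraceInverse Ωf Ωp CTI) ∧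
    ∀ CTI : ℝ, 0 < CTI → (∀ i, (T i).TraceInverse Ωf Ωp CTI) →
    ∀ ς : ℝ, ς = -1 ∨ ς = 0 ∨ ς = 1 →
    ∀ εhat εcheck γ : ℝ, 0 < εhat → 0 < εcheck →
      0 < 1 - (ς + 1) / 2 * εhat * CTI - εcheck / 2 →
      (ς + 1) * εhat⁻¹ < γ →
      (∃ c C : ℝ, 0 < c ∧ c < 1 ∧ 1 < C ∧
        c < min (1 - (ς + 1) / 2 * εhat * CTI - εcheck / 2) (γ - (ς + 1) * εhat⁻¹) ∧
        (2 * εcheck)⁻¹ < C ∧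
        StokesBiot.EnergyStable T Ωf Ωp γ ς c C) ∧
      ∀ c C : ℝ, 0 < c →
        c < min (1 - (ς + 1) / 2 * εhat * CTI - εcheck / 2) (γ - (ς + 1) * εhat⁻¹) →
        (2 * εcheck)⁻¹ < C →
        StokesBiot.EnergyStable T Ωf Ωp γ ς c C := by
  refine ⟨?_, fun CTI hCTI htr ς hς εhat εcheck γ hεhat hεcheck h₁ h₂ => ?_⟩
  · obtain ⟨CTI, hpos, h⟩ := StokesBiot.exists_traceInverse (by omega) Ωf Ωp k ρ θ
    exact ⟨CTI, hpos, fun i => h (T i) (hfe i) (hreg i)⟩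
  have hς' : 0 ≤ ς + 1 := by rcases hς with rfl | rfl | rfl <;> norm_num
  have hstable : ∀ c C : ℝ, 0 < c →
      c < min (1 - (ς + 1) / 2 * εhat * CTI - εcheck / 2) (γ - (ς + 1) * εhat⁻¹) →
      (2 * εcheck)⁻¹ < C → StokesBiot.EnergyStable T Ωf Ωp γ ς c C := fun c C _ hcm hC =>
    StokesBiot.energyStable_of_traceInverse (by omega) hfe hCTI htr hς' hεhat hεcheck
      (lt_min_iff.1 hcm).1 (lt_min_iff.1 hcm).2 hC
  refine ⟨?_, hstable⟩
  have hm : 0 < min (1 - (ς + 1) / 2 * εhat * CTI - εcheck / 2) (γ - (ς + 1) * εhat⁻¹) :=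
    lt_min h₁ (sub_pos.2 h₂)
  have hε' : 0 < (2 * εcheck)⁻¹ := by positivity
  have hlt := half_lt_self hm
  have hle : min (1 - (ς + 1) / 2 * εhat * CTI - εcheck / 2) (γ - (ς + 1) * εhat⁻¹) ≤ 1 := by
    have : 0 ≤ (ς + 1) / 2 * εhat * CTI := by positivity
    exact (min_le_left _ _).trans (by linarith)
  exact ⟨_, (2 * εcheck)⁻¹ + 1, half_pos hm, hlt.trans_le hle, by linarith, hlt, by linarith,
    hstable _ _ (half_pos hm) hlt (by linarith)⟩
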